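/- **Setting.** Let $k\ge 1$, $\beta_0\in\mathbb R$, $\alpha\in(0,1)$, and let $\Sigma$ be a known symmetric positive definite $2k\times 2k$ matrix. Let $R$ be a random $k\times 2$ matrix with $\mathrm{vec}(R)\sim N(a\otimes\mu,\Sigma)$, $a=(\beta,1)'$, where $\beta\in\mathbb R$ and $\mu\in\mathbb R^k$ are unknown; the null hypothesis is $H_0:\beta=\beta_0$. Put $\Delta=\beta-\beta_0$, $B_0=\begin{pmatrix}1&0\\-\beta_0&1\end{pmatrix}$, $R_0=RB_0$, $\Sigma_0=(B_0'\otimes I_k)\Sigma(B_0\otimes I_k)$, so that $\mathrm{vec}(R_0)\sim N(a_\Delta\otimes\mu,\Sigma_0)$ with $a_\Delta=(\Delta,1)'$; let $f_R(r_0;\Delta,\mu,\Sigma_0)$ be the density of this law. With $a_0=(\beta_0,1)'$ and $b_0=(1,-\beta_0)'$ define $$S=[(b_0'\otimes I_k)\Sigma(b_0\otimes I_k)]^{-1/2}(b_0'\otimes I_k)\mathrm{vec}(R),\qquad T=[(a_0'\otimes I_k)\Sigma^{-1}(a_0\otimes I_k)]^{-1/2}(a_0'\otimes I_k)\Sigma^{-1}\mathrm{vec}(R),$$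 which are in one-to-one correspondence with $R_0$, and let $f_S(s)=(2\pi)^{-k/2}e^{-s's/2}$, the density of $S$ under the null. A test is a measurable function $\phi(r_0,\sigma_0)$ with values in $[0,1]$, where $\sigma_0$ is the variance datum, which equals $\Sigma_0$ with probability one. Its rejection probability is $E_{\Delta,\mu,\Sigma_0}\phi=\int\phi(r_0,\sigma_0)\,f_R(r_0;\Delta,\mu,\Sigma_0)\,I(\sigma_0=\Sigma_0)\,dr_0\,\eta(d\sigma_0)$ with $\eta$ the counting measure, which equals $\int\phi(r_0,\Sigma_0)f_R(r_0;\Delta,\mu,\Sigma_0)\,dr_0$. It is similar at level $\alpha$ if $E_{0,\mu,\Sigma_0}\phi=\alpha$ for every $\mu\in\mathbb R^k$. Let $w_R$ be a Borel measure on $\mathbb R\times\mathbb R^k\ni(\Delta,\mu)$, let $w=w_R\times\delta_{\Sigma_0}$, and let $E_w\phi=\int E_{\Delta,\mu,\Sigma}\phi\;dw(\Delta,\mu,\Sigma)\in[0,\infty]$ be the weighted average power. Put $f_{w_R}(r_0,\Sigma_0)=\int f_R(r_0;\Delta,\mu,\Sigma_0)\,dw_R(\Delta,\mu)$. Assume that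 $f_{w_R}(r_0,\Sigma_0)<\infty$ for every $r_0$ (automatic if $w_R$ is finite) and that $w_R$ is not concentrated on null distributions, that is, $w_R(\{(\Delta,\mu):\Delta\neq0,\ \mu\neq0\})>0$. **Proposition.** Let $\kappa(t,\Sigma_0)$ be the $1-\alpha$ quantile of the null distribution, conditional on $T=t$, of the statistic $f_{w_R}(R_0,\Sigma_0)/f_S(S)$. The solution of $$\max_{\phi}\ E_w\phi\quad\text{over the tests }\phi\text{ that are similar at level }\alpha$$ is the nonrandomized test which rejects the null when $$\frac{f_{w_R}(r_0,\Sigma_0)}{f_S(s)}>\kappa(t,\Sigma_0),$$ where $s$ and $t$ are the values of $S$ and $T$ at the data. That is: there is a test that, at $\sigma_0=\Sigma_0$, is the indicator of this region in $r_0$, and this test is similar at level $\alpha$ and has maximal $E_w\phi$ among all tests similar at level $\alpha$; the same holds for every test that agrees with this indicator at $\sigma_0=\Sigma_0$ for Lebesgue-almost every $r_0$; and, if $w_R$ is a finite measure, every maximizer agrees with this indicator at $\sigma_0=\Sigma_0$ for Lebesgue-almost every $r_0$. -/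

import Mathlib

open MeasureTheory Matrix
open scoped ENNReal Kronecker MatrixOrder

namespace WAPSimilar

noncomputable section

/-! Borel structure and Lebesgue measure on real matrices (entrywise product structure). -/

instance instMeasurableSpaceMatrix {m n : Type*} : MeasurableSpace (Matrix m n ℝ) :=
  inferInstanceAs (MeasurableSpace (m → n → ℝ))

instance instMeasureSpaceMatrix {m n : Type*} [Fintype m] [Fintype n] :
    MeasureSpace (Matrix m n ℝ) :=
  { instMeasurableSpaceMatrix with
    volume := (volume : Measure (m → n → ℝ)) }

instance instMeasurableSingletonClassMatrix {m n : Type*} [Countable m] [Countable n] :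
    MeasurableSingletonClass (Matrix m n ℝ) :=
  inferInstanceAs (MeasurableSingletonClass (m → n → ℝ))

/-- The space of `k × 2` data matrices `R = [R₁ : R₂]`. -/
abbrev DataMat (k : ℕ) : Type := Matrix (Fin k) (Fin 2) ℝ

/-- The space of `2k × 2k` matrices, in `2 × 2` blocks of size `k × k`. The index `(j, i)` is that
of entry `(i, j)` of a data matrix under the column-stacking `Matrix.vec`. -/
abbrev CovMat (k : ℕ) : Type := Matrix (Fin 2 × Fin k) (Fin 2 × Fin k) ℝ

/-- `a_x = (x, 1)'`. -/
def aVec (x : ℝ) : Fin 2 → ℝ := ![x, 1]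

/-- `b_x = (1, -x)'`. -/
def bVec (x : ℝ) : Fin 2 → ℝ := ![1, -x]

/-- The `2k × k` matrix `c ⊗ I_k`, for a column vector `c ∈ ℝ²`. -/
def kronI (k : ℕ) (c : Fin 2 → ℝ) : Matrix (Fin 2 × Fin k) (Fin k) ℝ :=
  Matrix.of fun p j => c p.1 * (1 : Matrix (Fin k) (Fin k) ℝ) p.2 j

/-- `X^{-1/2}`, the inverse of the symmetric positive semidefinite square root. -/
def invSqrt {k : ℕ} (X : Matrix (Fin k) (Fin k) ℝ) : Matrix (Fin k) (Fin k) ℝ :=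
  (CFC.sqrt X)⁻¹

/-- `B₀ = [[1, 0], [-β₀, 1]]`; the transformed data are `R₀ = R B₀`. -/
def bMat (β₀ : ℝ) : Matrix (Fin 2) (Fin 2) ℝ := !![1, 0; -β₀, 1]

/-- `Σ₀ = (B₀' ⊗ I_k) Σ (B₀ ⊗ I_k)`, the variance of `vec(R₀)` when `Σ` is that of `vec(R)`. -/
def nullCov {k : ℕ} (β₀ : ℝ) (Sig : CovMat k) : CovMat k :=
  ((bMat β₀)ᵀ ⊗ₖ (1 : Matrix (Fin k) (Fin k) ℝ)) * Sig *
    (bMat β₀ ⊗ₖ (1 : Matrix (Fin k) (Fin k) ℝ))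

/-- `S = [(b₀' ⊗ I) Σ (b₀ ⊗ I)]^{-1/2} (b₀' ⊗ I) vec(R)`. -/
def statS {k : ℕ} (β₀ : ℝ) (Sig : CovMat k) (R : DataMat k) : Fin k → ℝ :=
  invSqrt ((kronI k (bVec β₀))ᵀ * Sig * kronI k (bVec β₀)) *ᵥ
    ((kronI k (bVec β₀))ᵀ *ᵥ R.vec)

/-- `T = [(a₀' ⊗ I) Σ⁻¹ (a₀ ⊗ I)]^{-1/2} (a₀' ⊗ I) Σ⁻¹ vec(R)`. -/
def statT {k : ℕ} (β₀ : ℝ) (Sig : CovMat k) (R : DataMat k) : Fin k → ℝ :=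
  invSqrt ((kronI k (aVec β₀))ᵀ * Sig⁻¹ * kronI k (aVec β₀)) *ᵥ
    ((kronI k (aVec β₀))ᵀ *ᵥ (Sig⁻¹ *ᵥ R.vec))

/-- The data matrix `r₀` at which `S = s` and `T = t`, when `vec(R₀)` has variance `Σ₀`:
`vec(r₀) = Σ₀ (e₁ ⊗ I) Σ₁₁^{-1/2} s + (e₂ ⊗ I) (Σ²²)^{-1/2} t`, where `Σ₁₁` and `Σ²²` are the first
diagonal block of `Σ₀` and the second diagonal block of `Σ₀⁻¹`. -/
def dataOfST {k : ℕ} (Sig₀ : CovMat k) (s t : Fin k → ℝ) : DataMat k :=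
  Matrix.of fun i j =>
    (Sig₀ *ᵥ (kronI k ![1, 0] *ᵥ
        (invSqrt ((kronI k ![1, 0])ᵀ * Sig₀ * kronI k ![1, 0]) *ᵥ s)) +
      kronI k ![0, 1] *ᵥ
        (invSqrt ((kronI k ![0, 1])ᵀ * Sig₀⁻¹ * kronI k ![0, 1]) *ᵥ t)) (j, i)

/-- The density `f_R(r₀; Δ, μ, Σ₀)` of `R₀ ~ N(μ a_Δ', Σ₀)`. -/
def densR {k : ℕ} (r₀ : DataMat k) (Δ : ℝ) (μ : Fin k → ℝ) (Sig₀ : CovMat k) : ℝ :=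
  (2 * Real.pi) ^ (-(k : ℝ)) * Sig₀.det ^ (-(1 / 2 : ℝ)) *
    Real.exp (-(1 / 2) * ((r₀ - vecMulVec μ (aVec Δ)).vec ⬝ᵥ
      (Sig₀⁻¹ *ᵥ (r₀ - vecMulVec μ (aVec Δ)).vec)))

open Classical in
/-- The density `f_Σ(σ₀; Σ₀) = I(σ₀ = Σ₀)` of the variance datum, w.r.t. counting measure. -/
def densSig {k : ℕ} (σ₀ Sig₀ : CovMat k) : ℝ := if σ₀ = Sig₀ then 1 else 0

/-- The density of `S` under the null: `f_S(s) = (2π)^{-k/2} exp(-s's/2)`. -/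
def densS {k : ℕ} (s : Fin k → ℝ) : ℝ :=
  (2 * Real.pi) ^ (-(k : ℝ) / 2) * Real.exp (-(s ⬝ᵥ s) / 2)

/-- A (possibly randomized) test: a measurable function `φ(r₀, σ₀)` with values in `[0, 1]`. -/
structure IsTest {k : ℕ} (φ : DataMat k → CovMat k → ℝ) : Prop where
  measurable : Measurable (Function.uncurry φ)
  nonneg : ∀ r₀ σ₀, 0 ≤ φ r₀ σ₀
  le_one : ∀ r₀ σ₀, φ r₀ σ₀ ≤ 1

/-- The rejection probability `E_{Δ,μ,Σ₀} φ(R₀, Σ₀)`: the integral of `φ` against the joint density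
of the data `(r₀, σ₀)`, w.r.t. Lebesgue measure in `r₀` and counting measure in `σ₀`. -/
def rejProb {k : ℕ} (φ : DataMat k → CovMat k → ℝ) (Δ : ℝ) (μ : Fin k → ℝ) (Sig₀ : CovMat k) :
    ℝ≥0∞ :=
  ∫⁻ σ₀ : CovMat k, ∫⁻ r₀ : DataMat k,
    ENNReal.ofReal (φ r₀ σ₀ * (densR r₀ Δ μ Sig₀ * densSig σ₀ Sig₀)) ∂volume ∂Measure.count

/-- The weighted average power `E_w φ(R₀, Σ₀)`, for a measure `w` on parameters `((Δ, μ), Σ₀)`. -/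
def wap {k : ℕ} (w : Measure ((ℝ × (Fin k → ℝ)) × CovMat k)) (φ : DataMat k → CovMat k → ℝ) :
    ℝ≥0∞ :=
  ∫⁻ θ, rejProb φ θ.1.1 θ.1.2 θ.2 ∂w

/-- A test that is similar at level `α`: its rejection probability is `α` for every `μ` under
`H₀ : Δ = 0`. -/
def IsSimilarTest {k : ℕ} (α : ℝ) (Sig₀ : CovMat k) (φ : DataMat k → CovMat k → ℝ) : Prop :=
  IsTest φ ∧ ∀ μ : Fin k → ℝ, rejProb φ 0 μ Sig₀ = ENNReal.ofReal α

/-- A solution of the problem of maximizing `E_w φ` over all tests that are similar at level `α`,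
for the weight `w = w_R × δ_{Σ₀}`. -/
def IsOptimalSimilarTest {k : ℕ} (α : ℝ) (Sig₀ : CovMat k) (wR : Measure (ℝ × (Fin k → ℝ)))
    (φ : DataMat k → CovMat k → ℝ) : Prop :=
  IsSimilarTest α Sig₀ φ ∧
    ∀ φ' : DataMat k → CovMat k → ℝ, IsSimilarTest α Sig₀ φ' →
      wap (wR.prod (Measure.dirac Sig₀)) φ' ≤ wap (wR.prod (Measure.dirac Sig₀)) φ

/-- The integrated likelihood `f_{w_R}(r₀, Σ₀) = ∫ f_R(r₀; Δ, μ, Σ₀) dw_R(Δ, μ)`. -/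
def intLik {k : ℕ} (wR : Measure (ℝ × (Fin k → ℝ))) (r₀ : DataMat k) (Sig₀ : CovMat k) : ℝ≥0∞ :=
  ∫⁻ p, ENNReal.ofReal (densR r₀ p.1 p.2 Sig₀) ∂wR

/-- The critical value `κ(t, Σ₀)`: the `1 - α` quantile of the null distribution, conditional on
`T = t`, of `f_{w_R}(R₀, Σ₀) / f_S(S)`. Under the null `S` is independent of `T` with density `f_S`,
so this is the quantile of the statistic at `(S, t)` for `S` of density `f_S`. -/
def critVal {k : ℕ} (α : ℝ) (wR : Measure (ℝ × (Fin k → ℝ))) (t : Fin k → ℝ) (Sig₀ : CovMat k) :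
    ℝ≥0∞ :=
  sInf {x : ℝ≥0∞ | ENNReal.ofReal (1 - α) ≤
    ∫⁻ s in {s : Fin k → ℝ |
        intLik wR (dataOfST Sig₀ s t) Sig₀ / ENNReal.ofReal (densS s) ≤ x},
      ENNReal.ofReal (densS s)}

/-- The rejection region `f_{w_R}(r₀, Σ₀) / f_S(s) > κ(t, Σ₀)`, where `s` and `t` are the values of
`S` and `T` at the data `r = r₀ B₀⁻¹`. -/
def rejects {k : ℕ} (α β₀ : ℝ) (Sig : CovMat k) (wR : Measure (ℝ × (Fin k → ℝ)))
    (r₀ : DataMat k) : Prop :=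
  intLik wR r₀ (nullCov β₀ Sig) / ENNReal.ofReal (densS (statS β₀ Sig (r₀ * (bMat β₀)⁻¹))) >
    critVal α wR (statT β₀ Sig (r₀ * (bMat β₀)⁻¹)) (nullCov β₀ Sig)

end

end WAPSimilar

/-! The pair (S, T) is a linear change of coordinates that turns the variance `Σ₀` into the
identity. Hence S and T are independent standard Gaussian vectors up to their means (`densR_eq`).
Under the null S has mean zero, while the mean of T ranges over all of ℝ^k. The Gaussian location
family is complete (`ae_eq_of_lintegral_densS_sub`), so a test is similar exactly when its
conditional rejection probability given T = t is α for almost every t (`isSimilarTest_iff`).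

By Tonelli, weighted average power is, up to the Jacobian constant, the integral over t of ∫ φ ·
ratio against the null law of S, where ratio = f_w / f_S (`det_mul_wap_eq`). The constraint and the
objective thus both split over t. For each t there remains the problem of testing one density
against another at level α, which `neyman_pearson` solves by thresholding the ratio.

No randomization is needed, because the ratio has no atoms given T = t. In s it is a constant times
the Laplace transform of a measure on the means of S (`ratio_eq_laplace`). Such a transform is
convex, and each finite level set lies in the boundary of a convex set unless the measure sits at
the origin (`volume_laplace_eq_const`); weight on Δ ≠ 0, μ ≠ 0 rules that out. The conditional
quantile is therefore finite and gives size exactly α (`critVal_spec`).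

For uniqueness, finite weight makes the maximal power finite. Equality of integrated powers then
forces equality for almost every t, and the equality case of Neyman-Pearson determines the test. -/

namespace WAPSimilar

/-! ### Quantiles, level sets of Laplace transforms, Neyman-Pearson -/

/-- If no level set of `g < ∞` is charged by the probability measure `ρ`, then `g` exceeds its
`1 - α` quantile with probability exactly `α`. -/
theorem measure_quantile_lt {X : Type*} [MeasurableSpace X] (ρ : Measure X)
    [IsProbabilityMeasure ρ] {g : X → ℝ≥0∞} (hg : Measurable g) (hlt : ∀ x, g x < ∞)
    (hlev : ∀ c < ∞, ρ {x | g x = c} = 0) {α : ℝ} (hα₀ : 0 < α) (hα₁ : α < 1) :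
    sInf {x : ℝ≥0∞ | ENNReal.ofReal (1 - α) ≤ ρ {y | g y ≤ x}} < ∞ ∧
    ρ {y | sInf {x : ℝ≥0∞ | ENNReal.ofReal (1 - α) ≤ ρ {y | g y ≤ x}} < g y} =
      ENNReal.ofReal α := by
  set A := {x : ℝ≥0∞ | ENNReal.ofReal (1 - α) ≤ ρ {y | g y ≤ x}} with hA
  set q := sInf A with hq
  have hsub : ENNReal.ofReal (1 - α) = 1 - ENNReal.ofReal α := by
    rw [ENNReal.ofReal_sub _ hα₀.le, ENNReal.ofReal_one]
  have hle1 : ENNReal.ofReal α ≤ 1 := by simpa using hα₁.le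
  have hne : A.Nonempty := by
    refine ⟨⊤, ?_⟩
    simp [hA, hα₀.le]
  have hle : ∀ x, MeasurableSet {y | g y ≤ x} := fun x => measurableSet_le hg measurable_const
  -- Take u n in `A` decreasing to q. Then {q < g} is the increasing union of the sets {u n < g},
  -- each of mass at most α.
  have hupper : ρ {y | q < g y} ≤ ENNReal.ofReal α := by
    obtain ⟨u, hu_anti, hu_tend, hu_mem⟩ := exists_seq_tendsto_sInf hne (OrderBot.bddBelow A)
    have hset : {y | q < g y} = ⋃ n, {y | u n < g y} := by
      ext y
      simp only [Set.mem_ofPred_eq, Set.mem_iUnion]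
      refine ⟨fun h => (hu_tend.eventually (gt_mem_nhds h)).exists, ?_⟩
      rintro ⟨n, hn⟩
      exact (sInf_le (hu_mem n)).trans_lt hn
    rw [hset, Directed.measure_iUnion]
    · refine iSup_le fun n => ?_
      have hc : {y | u n < g y} = {y | g y ≤ u n}ᶜ := by ext y; simp
      rw [hc, prob_compl_eq_one_sub (hle _)]
      have h := hu_mem n
      simp only [hA, Set.mem_ofPred_eq, hsub] at h
      exact tsub_le_iff_tsub_le.mp h
    · refine Monotone.directed_le fun m n hmn y hy => ?_
      exact (hu_anti hmn).trans_lt hy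
  -- Values below q are not in `A`, so {g < q} is an increasing union of sets of mass less than 1 -
  -- α.
  have hlower : ρ {y | g y < q} ≤ ENNReal.ofReal (1 - α) := by
    by_cases hq0 : q = 0
    · simp [hq0]
    obtain ⟨u, hu_mono, hu_lt, hu_tend⟩ :=
      exists_seq_strictMono_tendsto' (pos_iff_ne_zero.mpr hq0)
    have hset : {y | g y < q} = ⋃ n, {y | g y ≤ u n} := by
      ext y
      simp only [Set.mem_ofPred_eq, Set.mem_iUnion]
      refine ⟨fun h => ?_, ?_⟩
      · obtain ⟨n, hn⟩ := (hu_tend.eventually (lt_mem_nhds h)).exists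
        exact ⟨n, hn.le⟩
      rintro ⟨n, hn⟩
      exact hn.trans_lt (hu_lt n).2
    rw [hset, Directed.measure_iUnion]
    · refine iSup_le fun n => ?_
      by_contra h
      exact (hu_lt n).2.not_ge (sInf_le (not_le.mp h).le)
    · refine Monotone.directed_le fun m n hmn y hy => ?_
      exact le_trans hy (hu_mono.monotone hmn)
  have hqt : q < ∞ := by
    by_contra h
    have hq' : q = ∞ := by simpa using h
    rw [hq'] at hlower
    simp only [hlt, Set.ofPred_true, measure_univ, hsub] at hlower
    have : 1 - ENNReal.ofReal α < 1 :=
      ENNReal.sub_lt_self ENNReal.one_ne_top one_ne_zero (by simpa using hα₀)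
    exact absurd hlower this.not_ge
  refine ⟨hqt, le_antisymm hupper ?_⟩
  have hcompl : {y | q < g y} = {y | g y ≤ q}ᶜ := by ext y; simp
  have hunion : {y | g y ≤ q} = {y | g y < q} ∪ {y | g y = q} := by
    ext y; simp [le_iff_lt_or_eq]
  have hleq : ρ {y | g y ≤ q} ≤ ENNReal.ofReal (1 - α) := by
    rw [hunion]
    refine (measure_union_le _ _).trans ?_
    rw [hlev q hqt, add_zero]
    exact hlower
  rw [hcompl, prob_compl_eq_one_sub (hle _)]
  calc ENNReal.ofReal α = 1 - ENNReal.ofReal (1 - α) := by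
        rw [hsub, ENNReal.sub_sub_cancel ENNReal.one_ne_top hle1]
    _ ≤ _ := tsub_le_tsub_left hleq 1

/-- The quantile of a jointly measurable family of distribution functions is measurable. -/
theorem measurable_sInf_setOf_le {Y : Type*} [MeasurableSpace Y] {F : Y → ℝ≥0∞ → ℝ≥0∞} {a : ℝ≥0∞}
    (hF : ∀ x, Measurable fun y => F y x) (hmono : ∀ y, Monotone (F y)) :
    Measurable fun y => sInf {x | a ≤ F y x} := by
  -- By monotonicity, the infimum is below b exactly when some point of a fixed countable dense set
  -- below b satisfies the condition. This makes the preimage a countable union.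
  refine measurable_of_Iio fun b => ?_
  obtain ⟨D, hDc, hDd⟩ := TopologicalSpace.exists_countable_dense ℝ≥0∞
  have : (fun y => sInf {x | a ≤ F y x}) ⁻¹' Set.Iio b =
      ⋃ q ∈ D ∩ Set.Iio b, {y | a ≤ F y q} := by
    ext y
    simp only [Set.mem_preimage, Set.mem_Iio, sInf_lt_iff, Set.mem_ofPred_eq,
      Set.mem_iUnion, exists_prop, Set.mem_inter_iff]
    constructor
    · rintro ⟨x, hx, hxb⟩
      obtain ⟨q, hq, hxq, hqb⟩ := hDd.exists_between hxb
      exact ⟨q, ⟨hq, hqb⟩, hx.trans (hmono y hxq.le)⟩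
    · rintro ⟨q, ⟨-, hqb⟩, hq⟩
      exact ⟨q, hq, hqb⟩
  rw [this]
  exact MeasurableSet.biUnion (hDc.mono Set.inter_subset_left)
    fun q _ => measurableSet_le measurable_const (hF q)

/-- Level sets of a finite Laplace transform are Lebesgue null, unless the transformed measure is
concentrated at the origin. -/
theorem volume_laplace_eq_const {ι Ω : Type*} [Fintype ι] [MeasurableSpace Ω] (ν : Measure Ω)
    {X : Ω → ι → ℝ} (hX : Measurable X) (hν : ¬ ∀ᵐ ω ∂ν, X ω = 0) {c : ℝ≥0∞} (hc : c < ∞) :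
    volume {s : ι → ℝ | ∫⁻ ω, ENNReal.ofReal (Real.exp (s ⬝ᵥ X ω)) ∂ν = c} = 0 := by
  classical
  set Lp : (ι → ℝ) → ℝ≥0∞ := fun s => ∫⁻ ω, ENNReal.ofReal (Real.exp (s ⬝ᵥ X ω)) ∂ν with hLp
  have hm : ∀ s : ι → ℝ, Measurable fun ω => ENNReal.ofReal (Real.exp (s ⬝ᵥ X ω)) := by
    intro s
    have : Measurable fun ω => s ⬝ᵥ X ω := by
      simp only [dotProduct]; fun_prop
    fun_prop
  have hconv : Convex ℝ {s | Lp s ≤ c} := by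
    intro s hs s' hs' a b ha hb hab
    have key : Lp (a • s + b • s') ≤ ENNReal.ofReal a * Lp s + ENNReal.ofReal b * Lp s' := by
      rw [hLp]
      simp only
      rw [← lintegral_const_mul _ (hm s), ← lintegral_const_mul _ (hm s'),
        ← lintegral_add_left ((hm s).const_mul _)]
      refine lintegral_mono fun ω => ?_
      rw [← ENNReal.ofReal_mul ha, ← ENNReal.ofReal_mul hb,
        ← ENNReal.ofReal_add (by positivity) (by positivity)]
      refine ENNReal.ofReal_le_ofReal ?_
      rw [add_dotProduct, smul_dotProduct, smul_dotProduct]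
      exact convexOn_exp.2 (Set.mem_univ _) (Set.mem_univ _) ha hb hab
    refine key.trans ?_
    calc ENNReal.ofReal a * Lp s + ENNReal.ofReal b * Lp s'
        ≤ ENNReal.ofReal a * c + ENNReal.ofReal b * c := by gcongr <;> assumption
      _ = c := by rw [← add_mul, ← ENNReal.ofReal_add ha hb, hab]; simp
  -- The frontier of a convex set is Lebesgue null, so it suffices that no point of the level set is
  -- interior to the sublevel set.
  refine measure_mono_null ?_ (hconv.addHaar_frontier volume)
  intro s hs
  have hs : Lp s = c := hs
  refine ⟨subset_closure hs.le, fun hint => hν ?_⟩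
  have hcoord : ∀ i, ∀ᵐ ω ∂ν, X ω i = 0 := by
    intro i
    have hcont : Continuous fun e : ℝ => s + e • (Pi.single i 1 : ι → ℝ) := by fun_prop
    have hnhds : ∀ᶠ e in nhds (0 : ℝ), s + e • (Pi.single i 1 : ι → ℝ) ∈ {s | Lp s ≤ c} := by
      refine hcont.continuousAt.eventually_mem ?_
      simpa using mem_interior_iff_mem_nhds.mp hint
    obtain ⟨δ, hδ, hball⟩ := Metric.eventually_nhds_iff.mp hnhds
    have hp := hball (y := δ / 2)
      (by rw [Real.dist_eq, sub_zero, abs_of_pos (half_pos hδ)]; linarith)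
    have hn := hball (y := -(δ / 2))
      (by rw [Real.dist_eq, sub_zero, abs_neg, abs_of_pos (half_pos hδ)]; linarith)
    -- At an interior point s with value c, both s ± (δ/2)eᵢ have value at most c. Yet e^x + e^(-x)
    -- ≥ 2 bounds the sum of the two integrands below by twice the integrand at s. The integrals
    -- therefore agree and equality holds almost everywhere, which forces x = (δ/2) Xᵢ = 0.
    have hae := ae_eq_of_ae_le_of_lintegral_le (μ := ν)
      (f := fun ω => ENNReal.ofReal (Real.exp (s ⬝ᵥ X ω)) + ENNReal.ofReal (Real.exp (s ⬝ᵥ X ω)))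
      (g := fun ω => ENNReal.ofReal (Real.exp ((s + (δ / 2) • (Pi.single i 1 : ι → ℝ)) ⬝ᵥ X ω)) +
        ENNReal.ofReal (Real.exp ((s + (-(δ / 2)) • (Pi.single i 1 : ι → ℝ)) ⬝ᵥ X ω)))
      (Filter.Eventually.of_forall fun ω => ?_) ?_ ((hm _).add (hm _)).aemeasurable ?_
    · filter_upwards [hae] with ω hω
      rw [← ENNReal.ofReal_add (by positivity) (by positivity),
        ← ENNReal.ofReal_add (by positivity) (by positivity),
        ENNReal.ofReal_eq_ofReal_iff (by positivity) (by positivity)] at hω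
      simp only [add_dotProduct, smul_dotProduct, single_dotProduct, one_mul, Real.exp_add,
        smul_eq_mul] at hω
      have h2 : Real.exp (δ / 2 * X ω i) + Real.exp (-(δ / 2) * X ω i) = 2 := by
        have := Real.exp_pos (s ⬝ᵥ X ω)
        apply mul_left_cancel₀ this.ne'
        linarith
      have h3 : Real.exp (δ / 2 * X ω i) * Real.exp (-(δ / 2) * X ω i) = 1 := by
        rw [← Real.exp_add]; simp
      have h4 : Real.exp (δ / 2 * X ω i) = 1 := by
        have : (Real.exp (δ / 2 * X ω i) - 1) ^ 2 = 0 := by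
          have e : Real.exp (-(δ / 2) * X ω i) = 2 - Real.exp (δ / 2 * X ω i) := by linarith
          rw [e] at h3; nlinarith
        have := pow_eq_zero_iff (two_ne_zero) |>.mp this
        linarith
      rw [Real.exp_eq_one_iff] at h4
      rcases mul_eq_zero.mp h4 with h | h
      · exact absurd h (half_pos hδ).ne'
      · exact h
    · beta_reduce
      rw [← ENNReal.ofReal_add (by positivity) (by positivity),
        ← ENNReal.ofReal_add (by positivity) (by positivity)]
      refine ENNReal.ofReal_le_ofReal ?_
      simp only [add_dotProduct, smul_dotProduct, single_dotProduct, one_mul, Real.exp_add,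
        smul_eq_mul]
      have h1 := Real.add_one_le_exp (δ / 2 * X ω i)
      have h2 := Real.add_one_le_exp (-(δ / 2) * X ω i)
      have := Real.exp_pos (s ⬝ᵥ X ω)
      nlinarith
    · rw [lintegral_add_left (hm _)]
      change Lp s + Lp s ≠ ∞
      rw [hs]
      exact (ENNReal.add_lt_top.mpr ⟨hc, hc⟩).ne
    · rw [lintegral_add_left (hm _), lintegral_add_left (hm _)]
      change Lp _ + Lp _ ≤ Lp s + Lp s
      rw [hs]
      exact add_le_add hp hn
  filter_upwards [ae_all_iff.mpr hcoord] with ω hω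
  ext i
  exact hω i

/-- Neyman-Pearson: among tests of the same size, `1{c < g}` maximizes the integral of `g`; if the
maximum is finite and `{g = c}` is null, then it is the only maximizer. -/
theorem neyman_pearson {X : Type*} [MeasurableSpace X] (ρ : Measure X) {g u : X → ℝ≥0∞}
    (hg : Measurable g) (hu : Measurable u) (hu1 : ∀ x, u x ≤ 1) {c : ℝ≥0∞} (hc : c < ∞)
    {a : ℝ≥0∞} (ha : a < ∞) (hua : ∫⁻ x, u x ∂ρ = a) (hsize : ρ {x | c < g x} = a) :
    ∫⁻ x, u x * g x ∂ρ ≤ ∫⁻ x in {x | c < g x}, g x ∂ρ ∧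
    ((∀ x, g x < ∞) → ρ {x | g x = c} = 0 → ∫⁻ x in {x | c < g x}, g x ∂ρ < ∞ →
      ∫⁻ x, u x * g x ∂ρ = ∫⁻ x in {x | c < g x}, g x ∂ρ →
      ∀ᵐ x ∂ρ, u x = {x | c < g x}.indicator 1 x) := by
  have hset : MeasurableSet {x | c < g x} := measurableSet_lt measurable_const hg
  set I : X → ℝ≥0∞ := {x | c < g x}.indicator 1 with hI
  have hIm : Measurable I := measurable_one.indicator hset
  have hIint : ∫⁻ x, I x ∂ρ = a := by rw [hI, lintegral_indicator_one hset, hsize]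
  have hIg : ∫⁻ x in {x | c < g x}, g x ∂ρ = ∫⁻ x, I x * g x ∂ρ := by
    rw [← lintegral_indicator hset]
    refine lintegral_congr fun x => ?_
    by_cases hx : c < g x <;> simp [hI, hx]
  rw [hIg]
  -- This is (I - u)(g - c) ≥ 0, arranged without subtraction. Since I and u have the same finite
  -- integral, the terms in c cancel after integration.
  have hpt : ∀ x, u x * g x + I x * c ≤ I x * g x + u x * c := by
    intro x
    by_cases hx : c < g x
    · have : I x = 1 := by simp [hI, hx]
      rw [this, one_mul, one_mul]
      obtain ⟨d, hd⟩ := exists_add_of_le (hu1 x)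
      obtain ⟨e, he⟩ := exists_add_of_le hx.le
      rw [he]
      calc u x * (c + e) + c = u x * c + u x * e + c := by ring
        _ ≤ u x * c + 1 * e + c := by gcongr; exact hu1 x
        _ = c + e + u x * c := by ring
    · have : I x = 0 := by simp [hI, hx]
      rw [this, zero_mul, zero_mul, add_zero, zero_add]
      gcongr
      exact not_lt.mp hx
  have hl : ∫⁻ x, (u x * g x + I x * c) ∂ρ = ∫⁻ x, u x * g x ∂ρ + a * c := by
    rw [lintegral_add_left (f := fun x => u x * g x) (hu.mul hg), lintegral_mul_const _ hIm, hIint]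
  have hr : ∫⁻ x, (I x * g x + u x * c) ∂ρ = ∫⁻ x, I x * g x ∂ρ + a * c := by
    rw [lintegral_add_left (f := fun x => I x * g x) (hIm.mul hg), lintegral_mul_const _ hu, hua]
  have hac : a * c ≠ ∞ := ENNReal.mul_ne_top ha.ne hc.ne
  refine ⟨?_, fun hgt hlev hfin heq => ?_⟩
  · have := lintegral_mono (μ := ρ) hpt
    rw [hl, hr] at this
    exact (ENNReal.add_le_add_iff_right hac).mp this
  -- Equal finite integrals turn the pointwise inequality into (I - u)(g - c) = 0 almost everywhere,
  -- so u = I off the null set {g = c}.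
  · have hae := ae_eq_of_ae_le_of_lintegral_le (μ := ρ) (Filter.Eventually.of_forall hpt)
      (by rw [hl, heq]; exact (ENNReal.add_lt_top.mpr ⟨hfin, hac.lt_top⟩).ne)
      ((hIm.mul hg).add (hu.mul_const _)).aemeasurable (by rw [hl, hr, heq])
    have hne : ∀ᵐ x ∂ρ, g x ≠ c := by rw [ae_iff]; simpa using hlev
    filter_upwards [hae, hne] with x hx hgc
    have hut : u x ≠ ∞ := ((hu1 x).trans_lt ENNReal.one_lt_top).ne
    by_cases hcx : c < g x
    · have h1 : I x = 1 := by simp [hI, hcx]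
      rw [h1] at hx ⊢
      have hxr := congrArg ENNReal.toReal hx
      rw [one_mul, one_mul, ENNReal.toReal_add (ENNReal.mul_ne_top hut (hgt x).ne) hc.ne,
        ENNReal.toReal_add (hgt x).ne (ENNReal.mul_ne_top hut hc.ne), ENNReal.toReal_mul,
        ENNReal.toReal_mul] at hxr
      have hlt := (ENNReal.toReal_lt_toReal hc.ne (hgt x).ne).mpr hcx
      have : ((u x).toReal - 1) * ((g x).toReal - c.toReal) = 0 := by linarith
      rcases mul_eq_zero.mp this with h | h
      · rw [← ENNReal.toReal_eq_one_iff]; linarith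
      · exact absurd h (by linarith)
    · have h0 : I x = 0 := by simp [hI, hcx]
      rw [h0] at hx ⊢
      have hlt : g x < c := lt_of_le_of_ne (not_lt.mp hcx) hgc
      by_contra hux
      rw [zero_mul, zero_mul, add_zero, zero_add] at hx
      exact hlt.ne ((ENNReal.mul_right_inj hux hut).mp hx)

/-! ### The standard Gaussian law and completeness of its shifts -/

theorem densS_pos {k : ℕ} (s : Fin k → ℝ) : 0 < densS s := by
  unfold densS; positivity

theorem continuous_densS {k : ℕ} : Continuous (densS : (Fin k → ℝ) → ℝ) := by
  unfold densS; fun_prop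

@[fun_prop]
theorem measurable_densS {k : ℕ} : Measurable (densS : (Fin k → ℝ) → ℝ) :=
  continuous_densS.measurable

/-- Shifting a Gaussian is an exponential tilt. Completeness and the Laplace form of the test
statistic both rest on this. -/
theorem densS_sub {k : ℕ} (t m : Fin k → ℝ) :
    densS (t - m) = densS t * Real.exp (t ⬝ᵥ m - m ⬝ᵥ m / 2) := by
  unfold densS
  rw [mul_assoc, ← Real.exp_add]
  congr 2
  simp only [sub_dotProduct, dotProduct_sub, dotProduct_comm m t]
  ring

theorem densS_eq_prod {k : ℕ} (s : Fin k → ℝ) :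
    densS s = ∏ i, ProbabilityTheory.gaussianPDFReal 0 1 (s i) := by
  simp only [ProbabilityTheory.gaussianPDFReal, Finset.prod_mul_distrib, ← Real.exp_sum, densS,
    Finset.prod_const, Finset.card_univ, Fintype.card_fin]
  congr 1
  · rw [Real.sqrt_eq_rpow, ← Real.rpow_neg (by positivity), ← Real.rpow_natCast,
      ← Real.rpow_mul (by positivity)]
    simp only [NNReal.coe_one, mul_one]
    congr 1
    ring
  · simp only [dotProduct, sub_zero, NNReal.coe_one, mul_one, ← Finset.sum_div,
      Finset.sum_neg_distrib, pow_two]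

theorem lintegral_densS {k : ℕ} : ∫⁻ s : Fin k → ℝ, ENNReal.ofReal (densS s) = 1 := by
  have hint : Integrable (fun s : Fin k → ℝ => densS s) := by
    simp_rw [densS_eq_prod]
    exact Integrable.fintype_prod fun _ => ProbabilityTheory.integrable_gaussianPDFReal 0 1
  rw [← ofReal_integral_eq_lintegral_ofReal hint
    (Filter.Eventually.of_forall fun s => (densS_pos s).le)]
  simp_rw [densS_eq_prod]
  rw [integral_fintype_prod_volume_eq_pow (fun x => ProbabilityTheory.gaussianPDFReal 0 1 x),
    ProbabilityTheory.integral_gaussianPDFReal_eq_one 0 one_ne_zero]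
  simp

theorem lintegral_densS_sub {k : ℕ} (m : Fin k → ℝ) :
    ∫⁻ s : Fin k → ℝ, ENNReal.ofReal (densS (s - m)) = 1 := by
  rw [lintegral_sub_right_eq_self (fun s => ENNReal.ofReal (densS s)) m, lintegral_densS]

/-- The law of `S` under the null. -/
noncomputable def gaussS (k : ℕ) : Measure (Fin k → ℝ) :=
  volume.withDensity fun s => ENNReal.ofReal (densS s)

instance (k : ℕ) : IsProbabilityMeasure (gaussS k) :=
  ⟨by rw [gaussS, withDensity_apply _ MeasurableSet.univ, Measure.restrict_univ, lintegral_densS]⟩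

theorem gaussS_absolutelyContinuous (k : ℕ) : gaussS k ≪ volume :=
  withDensity_absolutelyContinuous _ _

theorem absolutelyContinuous_gaussS (k : ℕ) : volume ≪ gaussS k :=
  withDensity_absolutelyContinuous' (by fun_prop)
    (Filter.Eventually.of_forall fun s => (ENNReal.ofReal_pos.mpr (densS_pos s)).ne')

theorem lintegral_gaussS {k : ℕ} {h : (Fin k → ℝ) → ℝ≥0∞} (hh : Measurable h) :
    ∫⁻ s, h s ∂gaussS k = ∫⁻ s, ENNReal.ofReal (densS s) * h s := by
  rw [gaussS, lintegral_withDensity_eq_lintegral_mul _ (by fun_prop) hh]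
  rfl

/-- Completeness of the Gaussian location family: two bounded functions with the same means under
every shift of the standard Gaussian law agree almost everywhere. -/
theorem ae_eq_of_lintegral_densS_sub {k : ℕ} {h₁ h₂ : (Fin k → ℝ) → ℝ≥0∞} (hm₁ : Measurable h₁)
    (hm₂ : Measurable h₂) (hb₁ : ∀ t, h₁ t ≤ 1) (hb₂ : ∀ t, h₂ t ≤ 1)
    (h : ∀ m : Fin k → ℝ, ∫⁻ t, ENNReal.ofReal (densS (t - m)) * h₁ t =
      ∫⁻ t, ENNReal.ofReal (densS (t - m)) * h₂ t) : h₁ =ᵐ[volume] h₂ := by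
  have hle : ∀ {g : (Fin k → ℝ) → ℝ≥0∞}, (∀ t, g t ≤ 1) → ∀ m : Fin k → ℝ,
      ∫⁻ t, ENNReal.ofReal (densS (t - m)) * g t ≤ 1 := fun hg m =>
    (lintegral_mono fun t => mul_le_of_le_one_right' (hg t)).trans_eq (lintegral_densS_sub m)
  have hfin : ∀ {g : (Fin k → ℝ) → ℝ≥0∞}, (∀ t, g t ≤ 1) →
      IsFiniteMeasure ((gaussS k).withDensity g) := by
    refine fun hg => isFiniteMeasure_withDensity (ne_of_lt ?_)
    calc ∫⁻ t, _ ∂gaussS k ≤ ∫⁻ _, 1 ∂gaussS k := lintegral_mono hg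
      _ < ∞ := by simp
  have := hfin hb₁
  have := hfin hb₂
  -- By tilting, the means under shifts are the exponential moments of g times the Gaussian law, up
  -- to a factor that depends only on m.
  have hexp : ∀ {g : (Fin k → ℝ) → ℝ≥0∞}, Measurable g → ∀ (m : Fin k → ℝ),
      ∫⁻ t, ENNReal.ofReal (Real.exp (t ⬝ᵥ m)) ∂(gaussS k).withDensity g =
        ENNReal.ofReal (Real.exp (m ⬝ᵥ m / 2)) * ∫⁻ t, ENNReal.ofReal (densS (t - m)) * g t := by
    intro g hg m
    have hmm : Measurable fun t : Fin k → ℝ => ENNReal.ofReal (Real.exp (t ⬝ᵥ m)) := by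
      simp only [dotProduct]; fun_prop
    rw [lintegral_withDensity_eq_lintegral_mul _ hg hmm, lintegral_gaussS (hg.mul hmm),
      ← lintegral_const_mul _ (by fun_prop)]
    refine lintegral_congr fun t => ?_
    rw [densS_sub, ← mul_assoc, ← ENNReal.ofReal_mul (by positivity), Pi.mul_apply,
      mul_comm (g t), ← mul_assoc, ← ENNReal.ofReal_mul (densS_pos t).le]
    congr 2
    rw [mul_left_comm, ← Real.exp_add]
    congr 2
    ring
  have heq : (gaussS k).withDensity h₁ = (gaussS k).withDensity h₂ := by
    refine Measure.ext_of_charFunDual ?_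
    ext L
    set v : Fin k → ℝ := fun i => L (Pi.single i 1) with hv
    have hL : ∀ t, L t = t ⬝ᵥ v := by
      intro t
      conv_lhs => rw [pi_eq_sum_univ' t]
      simp [dotProduct, hv, map_sum]
    have hmgf : ∀ {g : (Fin k → ℝ) → ℝ≥0∞}, Measurable g → ∀ u : ℝ,
        ProbabilityTheory.mgf L ((gaussS k).withDensity g) u =
        (ENNReal.ofReal (Real.exp ((u • v) ⬝ᵥ (u • v) / 2)) *
          ∫⁻ t, ENNReal.ofReal (densS (t - u • v)) * g t).toReal := by
      intro g hg u
      rw [← hexp hg, ProbabilityTheory.mgf, integral_eq_lintegral_of_nonneg_ae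
        (Filter.Eventually.of_forall fun t => (Real.exp_pos _).le) (by fun_prop)]
      simp only [hL, dotProduct_smul, smul_eq_mul]
    have hmgf_eq : ProbabilityTheory.mgf L ((gaussS k).withDensity h₁) =
        ProbabilityTheory.mgf L ((gaussS k).withDensity h₂) := by
      funext u
      rw [hmgf hm₁, hmgf hm₂, h]
    -- All exponential moments are finite, so the complex moment generating function may be
    -- continued to the imaginary axis, where it is the characteristic function.
    have hset : ProbabilityTheory.integrableExpSet L ((gaussS k).withDensity h₁) = Set.univ := by
      refine Set.eq_univ_of_forall fun u => ?_
      refine ⟨by fun_prop, ?_⟩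
      rw [hasFiniteIntegral_iff_ofReal (Filter.Eventually.of_forall fun t => (Real.exp_pos _).le)]
      have := hexp hm₁ (u • v)
      simp only [dotProduct_smul, smul_eq_mul, ← hL] at this
      rw [this]
      exact ENNReal.mul_lt_top ENNReal.ofReal_lt_top ((hle hb₁ _).trans_lt ENNReal.one_lt_top)
    -- The continuation theorem asks that the two measures vanish together; the shift m = 0 compares
    -- their total masses.
    have hzero : (gaussS k).withDensity h₁ = 0 ↔ (gaussS k).withDensity h₂ = 0 := by
      have h0 := h 0
      simp only [sub_zero] at h0
      rw [← Measure.measure_univ_eq_zero, ← Measure.measure_univ_eq_zero,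
        withDensity_apply _ MeasurableSet.univ, withDensity_apply _ MeasurableSet.univ,
        Measure.restrict_univ, lintegral_gaussS hm₁, lintegral_gaussS hm₂, h0]
    have := ProbabilityTheory.eqOn_complexMGF_of_mgf' hmgf_eq hzero (x := Complex.I)
      (by rw [hset]; simp)
    simp only [ProbabilityTheory.complexMGF] at this
    simp only [charFunDual_apply]
    simpa only [mul_comm Complex.I] using this
  have hae := (withDensity_eq_iff hm₁.aemeasurable hm₂.aemeasurable ?_).mp heq
  · exact absolutelyContinuous_gaussS k hae
  · refine ((lintegral_mono hb₁).trans_lt ?_).ne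
    simp

/-! ### Linear algebra of c ⊗ I and inverse square roots -/

theorem kronI_mulVec {k : ℕ} (c : Fin 2 → ℝ) (μ : Fin k → ℝ) :
    kronI k c *ᵥ μ = (vecMulVec μ c).vec := by
  ext ⟨j, i⟩
  simp [kronI, mulVec, dotProduct, Matrix.vec, vecMulVec, Matrix.one_apply, mul_comm]

theorem transpose_kronI_mulVec_vec {k : ℕ} (c : Fin 2 → ℝ) (R : DataMat k) :
    (kronI k c)ᵀ *ᵥ R.vec = R *ᵥ c := by
  ext i
  simp [kronI, mulVec, dotProduct, Matrix.vec, Matrix.one_apply, Fintype.sum_prod_type, mul_comm]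

theorem transpose_kronI_mul_kronI {k : ℕ} (c d : Fin 2 → ℝ) :
    (kronI k c)ᵀ * kronI k d = (c ⬝ᵥ d) • (1 : Matrix (Fin k) (Fin k) ℝ) := by
  ext i j
  by_cases h : i = j
  · simp [kronI, mul_apply, dotProduct, Matrix.one_apply, Fintype.sum_prod_type, h]
  · simp [kronI, mul_apply, Matrix.one_apply, Fintype.sum_prod_type, h, Ne.symm h]

theorem kronI_mul_transpose_add {k : ℕ} :
    kronI k ![1, 0] * (kronI k ![1, 0])ᵀ + kronI k ![0, 1] * (kronI k ![0, 1])ᵀ = 1 := by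
  ext ⟨a, i⟩ ⟨b, j⟩
  fin_cases a <;> fin_cases b <;> simp [kronI, mul_apply, Matrix.one_apply]

theorem kronecker_one_mul_kronI {k : ℕ} (A : Matrix (Fin 2) (Fin 2) ℝ) (c : Fin 2 → ℝ) :
    (A ⊗ₖ (1 : Matrix (Fin k) (Fin k) ℝ)) * kronI k c = kronI k (A *ᵥ c) := by
  ext ⟨a, i⟩ j
  simp [kronI, mul_apply, mulVec, dotProduct, Matrix.one_apply, Fintype.sum_prod_type,
    kroneckerMap_apply]

theorem kronI_mulVec_injective {k : ℕ} {c : Fin 2 → ℝ} (hc : c ⬝ᵥ c ≠ 0) :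
    Function.Injective (kronI k c).mulVec := by
  intro x y h
  have h' := congrArg (fun z => (kronI k c)ᵀ *ᵥ z) h
  simp only [mulVec_mulVec, transpose_kronI_mul_kronI, smul_mulVec, one_mulVec] at h'
  exact smul_right_injective _ hc h'

theorem posDef_transpose_kronI_mul {k : ℕ} {W : CovMat k} (hW : W.PosDef) {c : Fin 2 → ℝ}
    (hc : c ⬝ᵥ c ≠ 0) : ((kronI k c)ᵀ * W * kronI k c).PosDef := by
  have := hW.conjTranspose_mul_mul_same (kronI_mulVec_injective (k := k) hc)
  rwa [conjTranspose_eq_transpose_of_trivial] at this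

theorem invSqrt_transpose {k : ℕ} (X : Matrix (Fin k) (Fin k) ℝ) :
    (invSqrt X)ᵀ = invSqrt X := by
  have h : (CFC.sqrt X)ᵀ = CFC.sqrt X := by
    have := (CFC.sqrt_nonneg X).isSelfAdjoint
    rw [← conjTranspose_eq_transpose_of_trivial]
    exact this
  rw [invSqrt, transpose_nonsing_inv, h]

theorem invSqrt_mul_mul_invSqrt {k : ℕ} {X : Matrix (Fin k) (Fin k) ℝ} (hX : X.PosDef) :
    invSqrt X * X * invSqrt X = 1 := by
  have h0 : 0 ≤ X := hX.posSemidef.nonneg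
  have hu : IsUnit (CFC.sqrt X).det :=
    (isUnit_iff_isUnit_det _).mp ((CFC.isUnit_sqrt_iff X h0).mpr hX.isUnit)
  unfold invSqrt
  nth_rw 2 [← CFC.sqrt_mul_sqrt_self X h0]
  rw [← mul_assoc, nonsing_inv_mul _ hu, one_mul, mul_nonsing_inv _ hu]

/-! ### The coordinates (S, T) and the factorization of the density -/

/-- `(Σ₁₁)^{-1/2}`, for the first diagonal block of the variance. -/
noncomputable def scaleS {k : ℕ} (W : CovMat k) : Matrix (Fin k) (Fin k) ℝ :=
  invSqrt ((kronI k ![1, 0])ᵀ * W * kronI k ![1, 0])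

/-- `(Σ²²)^{-1/2}`, for the second diagonal block of the inverse variance. -/
noncomputable def scaleT {k : ℕ} (W : CovMat k) : Matrix (Fin k) (Fin k) ℝ :=
  invSqrt ((kronI k ![0, 1])ᵀ * W⁻¹ * kronI k ![0, 1])

/-- `S` as a function of the transformed data. -/
noncomputable def nullS {k : ℕ} (W : CovMat k) (r : DataMat k) : Fin k → ℝ :=
  scaleS W *ᵥ ((kronI k ![1, 0])ᵀ *ᵥ r.vec)

/-- `T` as a function of the transformed data. -/
noncomputable def nullT {k : ℕ} (W : CovMat k) (r : DataMat k) : Fin k → ℝ :=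
  scaleT W *ᵥ ((kronI k ![0, 1])ᵀ *ᵥ (W⁻¹ *ᵥ r.vec))

/-- The matrix of the linear map `(s, t) ↦ vec(r₀)`. -/
noncomputable def frame {k : ℕ} (W : CovMat k) : CovMat k :=
  W * kronI k ![1, 0] * scaleS W * (kronI k ![1, 0])ᵀ +
    kronI k ![0, 1] * scaleT W * (kronI k ![0, 1])ᵀ

/-- The pair `(s, t)` as a vector indexed like `vec(r₀)`. -/
def pairVec {k : ℕ} (s t : Fin k → ℝ) : Fin 2 × Fin k → ℝ := fun p => ![s, t] p.1 p.2

theorem pairVec_eq_vec {k : ℕ} (s t : Fin k → ℝ) :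
    pairVec s t = (vecMulVec s ![1, 0] + vecMulVec t ![0, 1]).vec := by
  ext ⟨a, i⟩
  fin_cases a <;> simp [pairVec, vecMulVec, Matrix.vec]

theorem vec_dataOfST {k : ℕ} (W : CovMat k) (s t : Fin k → ℝ) :
    (dataOfST W s t).vec = frame W *ᵥ pairVec s t := by
  have h1 : (kronI k ![1, 0])ᵀ *ᵥ pairVec s t = s := by
    rw [pairVec_eq_vec, transpose_kronI_mulVec_vec]
    ext i; simp [mulVec, dotProduct, vecMulVec]
  have h2 : (kronI k ![0, 1])ᵀ *ᵥ pairVec s t = t := by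
    rw [pairVec_eq_vec, transpose_kronI_mulVec_vec]
    ext i; simp [mulVec, dotProduct, vecMulVec]
  rw [frame, add_mulVec]
  simp only [← mulVec_mulVec, h1, h2]
  rfl

theorem scaleS_spec {k : ℕ} {W : CovMat k} (hW : W.PosDef) :
    scaleS W * ((kronI k ![1, 0])ᵀ * W * kronI k ![1, 0]) * scaleS W = 1 :=
  invSqrt_mul_mul_invSqrt (posDef_transpose_kronI_mul hW (by simp))

theorem scaleT_spec {k : ℕ} {W : CovMat k} (hW : W.PosDef) :
    scaleT W * ((kronI k ![0, 1])ᵀ * W⁻¹ * kronI k ![0, 1]) * scaleT W = 1 :=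
  invSqrt_mul_mul_invSqrt (posDef_transpose_kronI_mul hW.inv (by simp))

theorem isUnit_det_posDef {k : ℕ} {W : CovMat k} (hW : W.PosDef) : IsUnit W.det :=
  hW.det_pos.ne'.isUnit

theorem transpose_posDef {k : ℕ} {W : CovMat k} (hW : W.PosDef) : Wᵀ = W := by
  rw [← conjTranspose_eq_transpose_of_trivial]
  exact hW.isHermitian

theorem transpose_kronI_fst_mul_snd {k : ℕ} : (kronI k ![1, 0])ᵀ * kronI k ![0, 1] = 0 := by
  rw [transpose_kronI_mul_kronI]; simp

theorem transpose_kronI_snd_mul_fst {k : ℕ} : (kronI k ![0, 1])ᵀ * kronI k ![1, 0] = 0 := by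
  rw [transpose_kronI_mul_kronI]; simp

/-- The factor `W` in the first summand of the frame cancels `W⁻¹`, leaving exactly the matrix of r
↦ (S, T). It is the inverse of the frame. -/
theorem frame_transpose_mul_inv {k : ℕ} {W : CovMat k} (hW : W.PosDef) :
    (frame W)ᵀ * W⁻¹ = kronI k ![1, 0] * (scaleS W * (kronI k ![1, 0])ᵀ) +
      kronI k ![0, 1] * (scaleT W * ((kronI k ![0, 1])ᵀ * W⁻¹)) := by
  simp only [frame, transpose_add, transpose_mul, transpose_transpose, transpose_posDef hW,
    scaleS, scaleT, invSqrt_transpose, Matrix.add_mul, Matrix.mul_assoc,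
    mul_nonsing_inv _ (isUnit_det_posDef hW), Matrix.mul_one]

/-- The diagonal blocks are 1 by the choice of the two square roots. The cross blocks vanish because
`W` and `W⁻¹` cancel and e₁ ⊥ e₂; this is the independence of S and T. -/
theorem frame_transpose_mul_inv_mul_frame {k : ℕ} {W : CovMat k} (hW : W.PosDef) :
    (frame W)ᵀ * W⁻¹ * frame W = 1 := by
  rw [← kronI_mul_transpose_add]
  have hS : ∀ X : Matrix (Fin k) (Fin 2 × Fin k) ℝ,
      scaleS W * ((kronI k ![1, 0])ᵀ * (W * (kronI k ![1, 0] * (scaleS W * X)))) = X := by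
    intro X
    have := congrArg (· * X) (scaleS_spec hW)
    simpa only [Matrix.mul_assoc, Matrix.one_mul] using this
  have hT : ∀ X : Matrix (Fin k) (Fin 2 × Fin k) ℝ,
      scaleT W * ((kronI k ![0, 1])ᵀ * (W⁻¹ * (kronI k ![0, 1] * (scaleT W * X)))) = X := by
    intro X
    have := congrArg (· * X) (scaleT_spec hW)
    simpa only [Matrix.mul_assoc, Matrix.one_mul] using this
  have h12 : ∀ X : Matrix (Fin k) (Fin 2 × Fin k) ℝ,
      (kronI k ![1, 0])ᵀ * (kronI k ![0, 1] * X) = 0 := by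
    intro X; rw [← Matrix.mul_assoc, transpose_kronI_fst_mul_snd, Matrix.zero_mul]
  have h21 : ∀ X : Matrix (Fin k) (Fin 2 × Fin k) ℝ,
      (kronI k ![0, 1])ᵀ * (kronI k ![1, 0] * X) = 0 := by
    intro X; rw [← Matrix.mul_assoc, transpose_kronI_snd_mul_fst, Matrix.zero_mul]
  have hinv : ∀ X : CovMat k, W⁻¹ * (W * X) = X := fun X =>
    nonsing_inv_mul_cancel_left _ _ (isUnit_det_posDef hW)
  rw [frame_transpose_mul_inv hW, frame]
  simp only [Matrix.add_mul, Matrix.mul_add, Matrix.mul_assoc, hS, hT, h12, h21, hinv,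
    Matrix.mul_zero, add_zero, zero_add]

theorem frame_mul_frame_transpose_mul_inv {k : ℕ} {W : CovMat k} (hW : W.PosDef) :
    frame W * ((frame W)ᵀ * W⁻¹) = 1 :=
  mul_eq_one_comm.mp (frame_transpose_mul_inv_mul_frame hW)

theorem det_frame_sq {k : ℕ} {W : CovMat k} (hW : W.PosDef) : (frame W).det ^ 2 = W.det := by
  have h := congrArg Matrix.det (frame_transpose_mul_inv_mul_frame hW)
  rw [det_mul, det_mul, det_transpose, det_nonsing_inv, Ring.inverse_eq_inv', det_one] at h
  have := hW.det_pos.ne'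
  field_simp at h
  linarith

theorem pairVec_nullS_nullT {k : ℕ} {W : CovMat k} (hW : W.PosDef) (r : DataMat k) :
    pairVec (nullS W r) (nullT W r) = ((frame W)ᵀ * W⁻¹) *ᵥ r.vec := by
  rw [pairVec_eq_vec, vec_add, ← kronI_mulVec, ← kronI_mulVec, frame_transpose_mul_inv hW]
  simp only [nullS, nullT, add_mulVec, ← mulVec_mulVec]

theorem pairVec_inj {k : ℕ} {s t s' t' : Fin k → ℝ} :
    pairVec s t = pairVec s' t' ↔ s = s' ∧ t = t' := by
  refine ⟨fun h => ⟨funext fun i => ?_, funext fun i => ?_⟩, by rintro ⟨rfl, rfl⟩; rfl⟩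
  · simpa [pairVec] using congrFun h (0, i)
  · simpa [pairVec] using congrFun h (1, i)

theorem pairVec_dotProduct {k : ℕ} (s t : Fin k → ℝ) :
    pairVec s t ⬝ᵥ pairVec s t = s ⬝ᵥ s + t ⬝ᵥ t := by
  simp [pairVec, dotProduct, Fintype.sum_prod_type]

theorem nullS_nullT_dataOfST {k : ℕ} {W : CovMat k} (hW : W.PosDef) (s t : Fin k → ℝ) :
    nullS W (dataOfST W s t) = s ∧ nullT W (dataOfST W s t) = t := by
  rw [← pairVec_inj, pairVec_nullS_nullT hW, vec_dataOfST, mulVec_mulVec,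
    frame_transpose_mul_inv_mul_frame hW, one_mulVec]

theorem dataOfST_nullS_nullT {k : ℕ} {W : CovMat k} (hW : W.PosDef) (r : DataMat k) :
    dataOfST W (nullS W r) (nullT W r) = r := by
  rw [← vec_inj, vec_dataOfST, pairVec_nullS_nullT hW, mulVec_mulVec,
    frame_mul_frame_transpose_mul_inv hW, one_mulVec]

/-- The frame carries the Euclidean form to the form of `W⁻¹`, so the Gaussian exponent separates
into an S part and a T part. -/
theorem vec_dotProduct_inv_mulVec_vec {k : ℕ} {W : CovMat k} (hW : W.PosDef) (r : DataMat k) :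
    r.vec ⬝ᵥ (W⁻¹ *ᵥ r.vec) = nullS W r ⬝ᵥ nullS W r + nullT W r ⬝ᵥ nullT W r := by
  rw [← pairVec_dotProduct, ← dataOfST_nullS_nullT hW r, vec_dataOfST,
    (nullS_nullT_dataOfST hW _ _).1, (nullS_nullT_dataOfST hW _ _).2]
  set u := pairVec (nullS W r) (nullT W r)
  rw [mulVec_mulVec, dotProduct_comm, dotProduct_mulVec, ← mulVec_transpose, mulVec_mulVec,
    ← Matrix.mul_assoc, frame_transpose_mul_inv_mul_frame hW, one_mulVec]

theorem nullS_sub {k : ℕ} (W : CovMat k) (r r' : DataMat k) :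
    nullS W (r - r') = nullS W r - nullS W r' := by
  simp only [nullS, vec_sub, mulVec_sub]

theorem nullT_sub {k : ℕ} (W : CovMat k) (r r' : DataMat k) :
    nullT W (r - r') = nullT W r - nullT W r' := by
  simp only [nullT, vec_sub, mulVec_sub]

/-- S sees only the first column Δμ of the mean. It is therefore centred under the null, whatever μ
is. -/
theorem nullS_mean {k : ℕ} (W : CovMat k) (Δ : ℝ) (μ : Fin k → ℝ) :
    nullS W (vecMulVec μ (aVec Δ)) = Δ • (scaleS W *ᵥ μ) := by
  rw [nullS, transpose_kronI_mulVec_vec, ← mulVec_smul]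
  congr 1
  ext i
  simp [vecMulVec, aVec, mulVec, dotProduct, mul_comm]

theorem scaleS_mulVec_eq_zero {k : ℕ} {W : CovMat k} (hW : W.PosDef) {μ : Fin k → ℝ}
    (h : scaleS W *ᵥ μ = 0) : μ = 0 := by
  rw [← one_mulVec μ, ← scaleS_spec hW, ← mulVec_mulVec, h, mulVec_zero]

theorem exists_nullT_mean_eq {k : ℕ} {W : CovMat k} (hW : W.PosDef) (m : Fin k → ℝ) :
    ∃ μ : Fin k → ℝ, nullT W (vecMulVec μ (aVec 0)) = m := by
  -- At Δ = 0 the mean of T is (Σ²²)^{-1/2} Σ²² μ, which `scaleT_spec` inverts. Completeness needs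
  -- every m to be attained.
  refine ⟨scaleT W *ᵥ m, ?_⟩
  have : aVec 0 = ![0, 1] := rfl
  rw [nullT, this, ← kronI_mulVec]
  simp only [mulVec_mulVec]
  have h := scaleT_spec hW
  simp only [Matrix.mul_assoc] at h ⊢
  rw [h, one_mulVec]

theorem densR_eq {k : ℕ} {W : CovMat k} (hW : W.PosDef) (r : DataMat k) (Δ : ℝ)
    (μ : Fin k → ℝ) :
    densR r Δ μ W = W.det ^ (-(1 / 2 : ℝ)) * (densS (nullS W r - Δ • (scaleS W *ᵥ μ)) *
      densS (nullT W r - nullT W (vecMulVec μ (aVec Δ)))) := by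
  rw [densR, vec_dotProduct_inv_mulVec_vec hW, nullS_sub, nullT_sub, nullS_mean]
  unfold densS
  have h1 : (2 * Real.pi) ^ (-(k : ℝ)) =
      (2 * Real.pi) ^ (-(k : ℝ) / 2) * (2 * Real.pi) ^ (-(k : ℝ) / 2) := by
    rw [← Real.rpow_add (by positivity)]; congr 1; ring
  have h2 : ∀ a b : ℝ, Real.exp (-(1 / 2) * (a + b)) = Real.exp (-a / 2) * Real.exp (-b / 2) := by
    intro a b; rw [← Real.exp_add]; congr 1; ring
  rw [h1, h2]
  ring

theorem densR_dataOfST {k : ℕ} {W : CovMat k} (hW : W.PosDef) (s t : Fin k → ℝ) (Δ : ℝ)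
    (μ : Fin k → ℝ) :
    densR (dataOfST W s t) Δ μ W = W.det ^ (-(1 / 2 : ℝ)) * (densS (s - Δ • (scaleS W *ᵥ μ)) *
      densS (t - nullT W (vecMulVec μ (aVec Δ)))) := by
  rw [densR_eq hW, (nullS_nullT_dataOfST hW s t).1, (nullS_nullT_dataOfST hW s t).2]

/-! ### From the original data to the transformed data -/

theorem det_bMat (β₀ : ℝ) : (bMat β₀).det = 1 := by simp [bMat, det_fin_two]

theorem posDef_nullCov {k : ℕ} (β₀ : ℝ) {Sig : CovMat k} (hSig : Sig.PosDef) :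
    (nullCov β₀ Sig).PosDef := by
  set K : CovMat k := bMat β₀ ⊗ₖ (1 : Matrix (Fin k) (Fin k) ℝ) with hK
  have hdet : IsUnit K.det := by
    rw [hK, det_kronecker, det_bMat]; simp
  have hinj : Function.Injective K.mulVec :=
    mulVec_injective_of_isUnit ((isUnit_iff_isUnit_det _).mpr hdet)
  have := hSig.conjTranspose_mul_mul_same hinj
  rwa [conjTranspose_eq_transpose_of_trivial, hK, ← kroneckerMap_transpose, transpose_one] at this

/-- Since B₀e₁ = b₀, both the variance block and the linear form of S transform into their e₁
versions. -/
theorem statS_mul_inv {k : ℕ} (β₀ : ℝ) (Sig : CovMat k) (r : DataMat k) :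
    statS β₀ Sig (r * (bMat β₀)⁻¹) = nullS (nullCov β₀ Sig) r := by
  have hu : IsUnit (bMat β₀).det := by rw [det_bMat]; exact isUnit_one
  have hb : bMat β₀ *ᵥ ![1, 0] = bVec β₀ := by
    ext i; fin_cases i <;> simp [bMat, bVec, mulVec, dotProduct]
  have hvec : (r * (bMat β₀)⁻¹) *ᵥ bVec β₀ = r *ᵥ ![1, 0] := by
    rw [← hb, mulVec_mulVec, nonsing_inv_mul_cancel_right _ _ hu]
  have hcov : (kronI k ![1, 0])ᵀ * nullCov β₀ Sig * kronI k ![1, 0] =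
      (kronI k (bVec β₀))ᵀ * Sig * kronI k (bVec β₀) := by
    rw [← hb, ← kronecker_one_mul_kronI, nullCov, transpose_mul, ← kroneckerMap_transpose,
      transpose_one]
    simp only [Matrix.mul_assoc]
  rw [statS, nullS, scaleS, hcov, transpose_kronI_mulVec_vec, transpose_kronI_mulVec_vec, hvec]

/-- The inverse variance transforms by the inverse of B₀, and B₀'⁻¹e₂ = a₀ plays the role that B₀e₁
= b₀ plays for S. -/
theorem statT_mul_inv {k : ℕ} (β₀ : ℝ) (Sig : CovMat k) (r : DataMat k) :
    statT β₀ Sig (r * (bMat β₀)⁻¹) = nullT (nullCov β₀ Sig) r := by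
  have hu : IsUnit (bMat β₀).det := by rw [det_bMat]; exact isUnit_one
  have hut : IsUnit (bMat β₀)ᵀ.det := by rwa [det_transpose]
  have ha : (bMat β₀)ᵀ⁻¹ *ᵥ ![0, 1] = aVec β₀ := by
    have : (bMat β₀)ᵀ *ᵥ aVec β₀ = ![0, 1] := by
      ext i; fin_cases i <;> simp [bMat, aVec, mulVec, dotProduct]
    rw [← this, mulVec_mulVec, nonsing_inv_mul _ hut, one_mulVec]
  have hinv : (nullCov β₀ Sig)⁻¹ = ((bMat β₀)⁻¹ ⊗ₖ (1 : Matrix (Fin k) (Fin k) ℝ)) * Sig⁻¹ *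
      ((bMat β₀)ᵀ⁻¹ ⊗ₖ (1 : Matrix (Fin k) (Fin k) ℝ)) := by
    rw [nullCov, Matrix.mul_inv_rev, Matrix.mul_inv_rev, inv_kronecker, inv_kronecker, inv_one,
      Matrix.mul_assoc]
  have hleft : (kronI k ![0, 1])ᵀ * ((bMat β₀)⁻¹ ⊗ₖ (1 : Matrix (Fin k) (Fin k) ℝ)) =
      (kronI k (aVec β₀))ᵀ := by
    rw [← ha, ← kronecker_one_mul_kronI, transpose_mul, ← kroneckerMap_transpose, transpose_one,
      transpose_nonsing_inv, transpose_transpose]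
  have hcov : (kronI k ![0, 1])ᵀ * (nullCov β₀ Sig)⁻¹ * kronI k ![0, 1] =
      (kronI k (aVec β₀))ᵀ * Sig⁻¹ * kronI k (aVec β₀) := by
    rw [hinv, ← hleft, Matrix.mul_assoc, Matrix.mul_assoc, kronecker_one_mul_kronI, ha]
    simp only [Matrix.mul_assoc]
  have hvec : (kronI k ![0, 1])ᵀ *ᵥ ((nullCov β₀ Sig)⁻¹ *ᵥ r.vec) =
      (kronI k (aVec β₀))ᵀ *ᵥ (Sig⁻¹ *ᵥ (r * (bMat β₀)⁻¹).vec) := by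
    have hv : ((bMat β₀)ᵀ⁻¹ ⊗ₖ (1 : Matrix (Fin k) (Fin k) ℝ)) *ᵥ r.vec =
        (r * (bMat β₀)⁻¹).vec := by
      rw [kronecker_mulVec_vec, Matrix.one_mul, transpose_nonsing_inv, transpose_transpose]
    rw [hinv, ← hleft, ← hv]
    simp only [mulVec_mulVec, Matrix.mul_assoc]
  rw [statT, nullT, scaleT, hcov, hvec]

/-! ### Change of variables from data to (t, s) -/

theorem measurable_dataMat {k : ℕ} {Ω : Type*} [MeasurableSpace Ω] {f : Ω → DataMat k}
    (hf : ∀ i j, Measurable fun ω => f ω i j) : Measurable f :=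
  measurable_pi_lambda _ fun i => measurable_pi_lambda _ fun j => hf i j

theorem measurable_dataMat_apply {k : ℕ} (i : Fin k) (j : Fin 2) :
    Measurable fun r : DataMat k => r i j :=
  (measurable_pi_apply j).comp (measurable_pi_apply (X := fun _ : Fin k => Fin 2 → ℝ) i)

@[fun_prop]
theorem measurable_mulVec {m n : Type*} [Fintype n] (A : Matrix m n ℝ) :
    Measurable fun v : n → ℝ => A *ᵥ v := by
  refine measurable_pi_lambda _ fun i => ?_
  simp only [mulVec, dotProduct]
  fun_prop

/-- Column stacking as a measurable equivalence. -/
def vecEquiv (k : ℕ) : DataMat k ≃ᵐ (Fin 2 × Fin k → ℝ) where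
  toFun := Matrix.vec
  invFun u := Matrix.of fun i j => u (j, i)
  left_inv _ := rfl
  right_inv _ := rfl
  measurable_toFun := measurable_pi_lambda _ fun p => measurable_dataMat_apply p.2 p.1
  measurable_invFun := measurable_dataMat fun i j => measurable_pi_apply (j, i)

@[fun_prop]
theorem measurable_vec {k : ℕ} : Measurable (Matrix.vec : DataMat k → _) :=
  (vecEquiv k).measurable

theorem map_vec_volume {k : ℕ} :
    (volume : Measure (DataMat k)).map (vecEquiv k) = volume := by
  refine (Measure.pi_eq fun s _ => ?_).symm
  rw [(vecEquiv k).map_apply]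
  have h : vecEquiv k ⁻¹' (Set.univ.pi s) =
      Set.univ.pi fun i : Fin k => Set.univ.pi fun j : Fin 2 => s (j, i) := by
    ext r
    exact ⟨fun h i _ j _ => h (j, i) trivial, fun h p _ => h p.2 trivial p.1 trivial⟩
  rw [h]
  change (volume : Measure (Fin k → Fin 2 → ℝ)) _ = _
  rw [volume_pi_pi]
  simp_rw [volume_pi_pi]
  rw [Fintype.prod_prod_type, Finset.prod_comm]

@[fun_prop]
theorem measurable_pairVec {k : ℕ} :
    Measurable fun p : (Fin k → ℝ) × (Fin k → ℝ) => pairVec p.2 p.1 := by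
  refine measurable_pi_lambda _ fun q => ?_
  obtain ⟨a, i⟩ := q
  fin_cases a <;> simp only [pairVec, Fin.zero_eta, Fin.mk_one, cons_val_zero, cons_val_one] <;>
    fun_prop

/-- Pairs are ordered (t, s) so that t becomes the outer, conditioning variable in iterated
integrals. -/
theorem map_pairVec_volume {k : ℕ} :
    (volume : Measure ((Fin k → ℝ) × (Fin k → ℝ))).map (fun p => pairVec p.2 p.1) = volume := by
  refine (Measure.pi_eq fun s hs => ?_).symm
  rw [Measure.map_apply measurable_pairVec (MeasurableSet.univ_pi hs)]
  have h : (fun p : (Fin k → ℝ) × (Fin k → ℝ) => pairVec p.2 p.1) ⁻¹' (Set.univ.pi s) =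
      (Set.univ.pi fun i : Fin k => s (1, i)) ×ˢ (Set.univ.pi fun i : Fin k => s (0, i)) := by
    ext p
    simp only [Set.mem_preimage, Set.mem_univ_pi, Prod.forall, Set.mem_prod, Fin.forall_fin_two,
      pairVec, cons_val_zero, cons_val_one]
    exact and_comm
  rw [h, Measure.volume_eq_prod, Measure.prod_prod, volume_pi_pi, volume_pi_pi,
    Fintype.prod_prod_type, Fin.prod_univ_two, mul_comm]

theorem measurable_dataOfST {k : ℕ} (W : CovMat k) :
    Measurable fun p : (Fin k → ℝ) × (Fin k → ℝ) => dataOfST W p.2 p.1 := by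
  have h : (fun p : (Fin k → ℝ) × (Fin k → ℝ) => dataOfST W p.2 p.1) =
      (vecEquiv k).symm ∘ (fun p => frame W *ᵥ pairVec p.2 p.1) := by
    funext p
    rw [Function.comp_apply, ← vec_dataOfST]
    rfl
  rw [h]
  exact (vecEquiv k).symm.measurable.comp ((measurable_mulVec _).comp measurable_pairVec)

/-- The constant is the inverse Jacobian: the squared determinant of the frame is det `W`. -/
theorem map_dataOfST_volume {k : ℕ} {W : CovMat k} (hW : W.PosDef) :
    (volume : Measure ((Fin k → ℝ) × (Fin k → ℝ))).map (fun p => dataOfST W p.2 p.1) =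
      ENNReal.ofReal (W.det ^ (-(1 / 2 : ℝ))) • volume := by
  have hdet : (frame W).det ≠ 0 := fun h => by
    have := det_frame_sq hW
    rw [h] at this
    exact hW.det_pos.ne' (by simpa using this.symm)
  have habs : |((frame W).det)⁻¹| = W.det ^ (-(1 / 2 : ℝ)) := by
    rw [Real.rpow_neg hW.det_pos.le, ← Real.sqrt_eq_rpow, ← det_frame_sq hW, Real.sqrt_sq_eq_abs,
      abs_inv]
  refine (vecEquiv k).map_measurableEquiv_injective ?_
  rw [Measure.map_map (vecEquiv k).measurable (measurable_dataOfST W), Measure.map_smul,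
    map_vec_volume]
  have hcomp : (vecEquiv k ∘ fun p : (Fin k → ℝ) × (Fin k → ℝ) => dataOfST W p.2 p.1) =
      toLin' (frame W) ∘ fun p => pairVec p.2 p.1 := by
    funext p
    exact vec_dataOfST W p.2 p.1
  have hlin : Measurable (toLin' (frame W)) := measurable_mulVec (frame W)
  rw [hcomp, ← Measure.map_map hlin measurable_pairVec, map_pairVec_volume,
    Real.map_matrix_volume_pi_eq_smul_volume_pi hdet, habs]

theorem lintegral_dataOfST {k : ℕ} {W : CovMat k} (hW : W.PosDef) {F : DataMat k → ℝ≥0∞}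
    (hF : Measurable F) :
    ENNReal.ofReal (W.det ^ (-(1 / 2 : ℝ))) * ∫⁻ r, F r =
      ∫⁻ t : Fin k → ℝ, ∫⁻ s : Fin k → ℝ, F (dataOfST W s t) := by
  have h := lintegral_map (μ := volume) hF (measurable_dataOfST W)
  rw [map_dataOfST_volume hW, lintegral_smul_measure, smul_eq_mul, Measure.volume_eq_prod,
    lintegral_prod (fun p => F (dataOfST W p.2 p.1))
      (hF.comp (measurable_dataOfST W)).aemeasurable] at h
  exact h

theorem ofReal_det_rpow_ne_zero {k : ℕ} {W : CovMat k} (hW : W.PosDef) :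
    ENNReal.ofReal (W.det ^ (-(1 / 2 : ℝ))) ≠ 0 :=
  (ENNReal.ofReal_pos.mpr (Real.rpow_pos_of_pos hW.det_pos _)).ne'

theorem ae_dataMat_iff {k : ℕ} {W : CovMat k} (hW : W.PosDef) {p : DataMat k → Prop}
    (hp : MeasurableSet {r | p r}) :
    (∀ᵐ r, p r) ↔ ∀ᵐ t : Fin k → ℝ, ∀ᵐ s : Fin k → ℝ, p (dataOfST W s t) := by
  have h1 : (∀ᵐ r, p r) ↔
      ∀ᵐ r ∂(ENNReal.ofReal (W.det ^ (-(1 / 2 : ℝ))) • (volume : Measure (DataMat k))), p r :=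
    (Measure.ae_ennreal_smul_measure_iff (ofReal_det_rpow_ne_zero hW)).symm
  rw [h1, ← map_dataOfST_volume hW, ae_map_iff (measurable_dataOfST W).aemeasurable hp,
    Measure.volume_eq_prod]
  exact Measure.ae_prod_iff_ae_ae (measurable_dataOfST W hp)

@[fun_prop]
theorem measurable_nullS {k : ℕ} (W : CovMat k) : Measurable (nullS W) :=
  (measurable_mulVec _).comp ((measurable_mulVec _).comp measurable_vec)

@[fun_prop]
theorem measurable_nullT {k : ℕ} (W : CovMat k) : Measurable (nullT W) :=
  (measurable_mulVec _).comp
    ((measurable_mulVec _).comp ((measurable_mulVec _).comp measurable_vec))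

/-! ### Means, measurability, and power as an integral of the integrated likelihood -/

/-- The mean of `S`. -/
noncomputable def meanS {k : ℕ} (W : CovMat k) (p : ℝ × (Fin k → ℝ)) : Fin k → ℝ :=
  p.1 • (scaleS W *ᵥ p.2)

/-- The mean of `T`. -/
noncomputable def meanT {k : ℕ} (W : CovMat k) (p : ℝ × (Fin k → ℝ)) : Fin k → ℝ :=
  nullT W (vecMulVec p.2 (aVec p.1))

@[fun_prop]
theorem measurable_meanS {k : ℕ} (W : CovMat k) : Measurable (meanS W) :=
  measurable_fst.smul ((measurable_mulVec _).comp measurable_snd)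

@[fun_prop]
theorem measurable_meanT {k : ℕ} (W : CovMat k) : Measurable (meanT W) := by
  refine (measurable_nullT W).comp (measurable_dataMat fun i j => ?_)
  simp only [vecMulVec_apply]
  fin_cases j <;> simp only [aVec, Fin.zero_eta, Fin.mk_one, cons_val_zero, cons_val_one] <;>
    fun_prop

theorem densR_pos {k : ℕ} {W : CovMat k} (hW : W.PosDef) (r : DataMat k) (Δ : ℝ)
    (μ : Fin k → ℝ) : 0 < densR r Δ μ W := by
  rw [densR_eq hW]
  exact mul_pos (Real.rpow_pos_of_pos hW.det_pos _) (mul_pos (densS_pos _) (densS_pos _))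

theorem measurable_densR {k : ℕ} {W : CovMat k} (hW : W.PosDef) :
    Measurable fun q : DataMat k × (ℝ × (Fin k → ℝ)) => densR q.1 q.2.1 q.2.2 W := by
  have h : (fun q : DataMat k × (ℝ × (Fin k → ℝ)) => densR q.1 q.2.1 q.2.2 W) = fun q =>
      W.det ^ (-(1 / 2 : ℝ)) * (densS (nullS W q.1 - meanS W q.2) *
        densS (nullT W q.1 - meanT W q.2)) := by
    funext q
    exact densR_eq hW _ _ _
  rw [h]
  fun_prop

/-- The likelihood at r₀ = 0 is a positive function of the parameters with finite integral. The
weight is thus a finite measure with a finite-valued density, and Tonelli applies to it. -/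
theorem sigmaFinite_of_intLik_lt_top {k : ℕ} {W : CovMat k} (hW : W.PosDef)
    {wR : Measure (ℝ × (Fin k → ℝ))} (hfin : ∀ r₀ : DataMat k, intLik wR r₀ W < ∞) :
    SigmaFinite wR := by
  set f : ℝ × (Fin k → ℝ) → ℝ≥0∞ := fun p => ENNReal.ofReal (densR 0 p.1 p.2 W) with hf
  have hm : Measurable f := ((measurable_densR hW).comp measurable_prodMk_left).ennreal_ofReal
  have hf0 : ∀ p, f p ≠ 0 := fun p => (ENNReal.ofReal_pos.mpr (densR_pos hW 0 p.1 p.2)).ne'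
  have : IsFiniteMeasure (wR.withDensity f) := isFiniteMeasure_withDensity (hfin 0).ne
  rw [← withDensity_inv_same (μ := wR) hm (Filter.Eventually.of_forall hf0)
    (Filter.Eventually.of_forall fun _ => ENNReal.ofReal_ne_top)]
  exact SigmaFinite.withDensity_of_ne_top
    (Filter.Eventually.of_forall fun p => ENNReal.inv_ne_top.mpr (hf0 p))

theorem measurable_densR_left {k : ℕ} {W : CovMat k} (hW : W.PosDef) (Δ : ℝ) (μ : Fin k → ℝ) :
    Measurable fun r : DataMat k => ENNReal.ofReal (densR r Δ μ W) := by
  have h : Measurable fun r : DataMat k => (r, (Δ, μ)) := measurable_prodMk_right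
  exact ((measurable_densR hW).comp h).ennreal_ofReal

theorem measurable_densR_right {k : ℕ} {W : CovMat k} (hW : W.PosDef) (r : DataMat k) :
    Measurable fun p : ℝ × (Fin k → ℝ) => ENNReal.ofReal (densR r p.1 p.2 W) := by
  have h : Measurable fun p : ℝ × (Fin k → ℝ) => (r, p) := measurable_prodMk_left
  exact ((measurable_densR hW).comp h).ennreal_ofReal

instance (k : ℕ) : SigmaFinite (volume : Measure (DataMat k)) :=
  inferInstanceAs (SigmaFinite (volume : Measure (Fin k → Fin 2 → ℝ)))

theorem measurable_intLik {k : ℕ} {W : CovMat k} (hW : W.PosDef)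
    (wR : Measure (ℝ × (Fin k → ℝ))) [SFinite wR] : Measurable fun r => intLik wR r W :=
  (measurable_densR hW).ennreal_ofReal.lintegral_prod_right'

theorem rejProb_eq {k : ℕ} (φ : DataMat k → CovMat k → ℝ) (Δ : ℝ) (μ : Fin k → ℝ)
    {W : CovMat k} (hφ : ∀ r, 0 ≤ φ r W) :
    rejProb φ Δ μ W = ∫⁻ r, ENNReal.ofReal (φ r W) * ENNReal.ofReal (densR r Δ μ W) := by
  rw [rejProb, lintegral_count, tsum_eq_single W]
  · refine lintegral_congr fun r => ?_
    rw [densSig, if_pos rfl, mul_one, ENNReal.ofReal_mul (hφ r)]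
  · intro σ hσ
    simp [densSig, hσ]

theorem IsTest.measurable_apply {k : ℕ} {φ : DataMat k → CovMat k → ℝ} (hφ : IsTest φ)
    (W : CovMat k) : Measurable fun r => φ r W := by
  have h : Measurable fun r : DataMat k => (r, W) := measurable_prodMk_right
  simpa only [Function.comp_def, Function.uncurry_apply_pair] using hφ.measurable.comp h

theorem IsTest.measurable_section {k : ℕ} {φ : DataMat k → CovMat k → ℝ} (hφ : IsTest φ)
    (W : CovMat k) : Measurable fun r => ENNReal.ofReal (φ r W) :=
  (hφ.measurable_apply W).ennreal_ofReal

theorem measurable_dataOfST_left {k : ℕ} (W : CovMat k) (t : Fin k → ℝ) :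
    Measurable fun s => dataOfST W s t := by
  have h : Measurable fun s : Fin k → ℝ => (t, s) := measurable_prodMk_left
  simpa only [Function.comp_def] using (measurable_dataOfST W).comp h

theorem IsTest.measurable_section_left {k : ℕ} {φ : DataMat k → CovMat k → ℝ} (hφ : IsTest φ)
    (W : CovMat k) (t : Fin k → ℝ) :
    Measurable fun s => ENNReal.ofReal (φ (dataOfST W s t) W) :=
  (hφ.measurable_section W).comp (measurable_dataOfST_left W t)

theorem IsTest.measurable_condSize {k : ℕ} {φ : DataMat k → CovMat k → ℝ} (hφ : IsTest φ)
    (W : CovMat k) :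
    Measurable fun t => ∫⁻ s, ENNReal.ofReal (φ (dataOfST W s t) W) ∂gaussS k := by
  have h : Measurable fun p : (Fin k → ℝ) × (Fin k → ℝ) =>
      ENNReal.ofReal (φ (dataOfST W p.2 p.1) W) :=
    (hφ.measurable_section W).comp (measurable_dataOfST W)
  exact h.lintegral_prod_right'

theorem wap_eq {k : ℕ} {φ : DataMat k → CovMat k → ℝ} (hφ : IsTest φ) {W : CovMat k}
    (hW : W.PosDef) (wR : Measure (ℝ × (Fin k → ℝ))) [SFinite wR] :
    wap (wR.prod (Measure.dirac W)) φ = ∫⁻ r, ENNReal.ofReal (φ r W) * intLik wR r W := by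
  rw [wap, Measure.prod_dirac, (measurableEmbedding_prod_mk_right W).lintegral_map]
  simp_rw [rejProb_eq φ _ _ fun r => hφ.nonneg r W]
  have hm := (measurable_densR hW).ennreal_ofReal
  rw [lintegral_lintegral_swap]
  · refine lintegral_congr fun r => ?_
    rw [lintegral_const_mul _ (measurable_densR_right hW r)]
    rfl
  · exact (((hφ.measurable_section W).comp measurable_snd).mul
      (hm.comp measurable_swap)).aemeasurable

/-! ### The statistic given T = t and its critical value -/

/-- The test statistic as a function of `s` and `t`. -/
noncomputable def ratio {k : ℕ} (wR : Measure (ℝ × (Fin k → ℝ))) (W : CovMat k)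
    (t s : Fin k → ℝ) : ℝ≥0∞ :=
  intLik wR (dataOfST W s t) W / ENNReal.ofReal (densS s)

theorem measurable_ratio {k : ℕ} {W : CovMat k} (hW : W.PosDef)
    (wR : Measure (ℝ × (Fin k → ℝ))) [SFinite wR] :
    Measurable fun p : (Fin k → ℝ) × (Fin k → ℝ) => ratio wR W p.1 p.2 :=
  ((measurable_intLik hW wR).comp (measurable_dataOfST W)).div (by fun_prop)

theorem measurable_ratio_right {k : ℕ} {W : CovMat k} (hW : W.PosDef)
    (wR : Measure (ℝ × (Fin k → ℝ))) [SFinite wR] (t : Fin k → ℝ) : Measurable (ratio wR W t) := by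
  have h : Measurable fun s : Fin k → ℝ => (t, s) := measurable_prodMk_left
  simpa only [Function.comp_def] using (measurable_ratio hW wR).comp h

theorem ratio_lt_top {k : ℕ} {W : CovMat k} {wR : Measure (ℝ × (Fin k → ℝ))}
    (hfin : ∀ r₀ : DataMat k, intLik wR r₀ W < ∞) (t s : Fin k → ℝ) : ratio wR W t s < ∞ :=
  ENNReal.div_lt_top (hfin _).ne (ENNReal.ofReal_pos.mpr (densS_pos s)).ne'

theorem densS_mul_ratio {k : ℕ} (W : CovMat k) (wR : Measure (ℝ × (Fin k → ℝ)))
    (t s : Fin k → ℝ) :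
    ENNReal.ofReal (densS s) * ratio wR W t s = intLik wR (dataOfST W s t) W :=
  ENNReal.mul_div_cancel (ENNReal.ofReal_pos.mpr (densS_pos s)).ne' ENNReal.ofReal_ne_top

theorem critVal_eq {k : ℕ} (α : ℝ) (wR : Measure (ℝ × (Fin k → ℝ))) (t : Fin k → ℝ)
    (W : CovMat k) :
    critVal α wR t W =
      sInf {x | ENNReal.ofReal (1 - α) ≤ gaussS k {s | ratio wR W t s ≤ x}} := by
  simp only [gaussS, withDensity_apply']
  rfl

theorem measurable_critVal {k : ℕ} (α : ℝ) {W : CovMat k} (hW : W.PosDef)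
    (wR : Measure (ℝ × (Fin k → ℝ))) [SFinite wR] :
    Measurable fun t => critVal α wR t W := by
  simp_rw [critVal_eq]
  refine measurable_sInf_setOf_le (F := fun t x => gaussS k {s | ratio wR W t s ≤ x})
    (fun x => ?_) fun t x y hxy => measure_mono fun s hs => le_trans hs hxy
  exact measurable_measure_prodMk_left (measurableSet_le (measurable_ratio hW wR) measurable_const)

/-- Given `T = t`, the statistic is a constant multiple of a Laplace transform in `s`. -/
theorem ratio_eq_laplace {k : ℕ} {W : CovMat k} (hW : W.PosDef)
    (wR : Measure (ℝ × (Fin k → ℝ))) (t s : Fin k → ℝ) :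
    ratio wR W t s = ENNReal.ofReal (W.det ^ (-(1 / 2 : ℝ))) *
      ∫⁻ p, ENNReal.ofReal (Real.exp (s ⬝ᵥ meanS W p)) ∂(wR.withDensity fun p =>
        ENNReal.ofReal (Real.exp (-(meanS W p ⬝ᵥ meanS W p / 2)) * densS (t - meanT W p))) := by
  have hm : Measurable fun p : ℝ × (Fin k → ℝ) =>
      ENNReal.ofReal (Real.exp (s ⬝ᵥ meanS W p)) := by
    simp only [dotProduct]
    fun_prop
  have hd : Measurable fun p : ℝ × (Fin k → ℝ) =>
      ENNReal.ofReal (Real.exp (-(meanS W p ⬝ᵥ meanS W p / 2)) * densS (t - meanT W p)) := by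
    simp only [dotProduct]
    fun_prop
  rw [lintegral_withDensity_eq_lintegral_mul _ hd hm, ← lintegral_const_mul _ (hd.mul hm), ratio,
    eq_comm, ENNReal.eq_div_iff (ENNReal.ofReal_pos.mpr (densS_pos s)).ne' ENNReal.ofReal_ne_top,
    ← lintegral_const_mul _ ((hd.mul hm).const_mul _), intLik, eq_comm]
  refine lintegral_congr fun p => ?_
  -- Tilting the S factor extracts f_S(s), which the denominator cancels. Only the exponential
  -- linear in s still depends on s.
  have h1 : densR (dataOfST W s t) p.1 p.2 W = densS s * (W.det ^ (-(1 / 2 : ℝ)) *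
      (Real.exp (-(meanS W p ⬝ᵥ meanS W p / 2)) * densS (t - meanT W p) *
        Real.exp (s ⬝ᵥ meanS W p))) := by
    rw [densR_dataOfST hW]
    change _ * (densS (s - meanS W p) * densS (t - meanT W p)) = _
    rw [densS_sub, sub_eq_add_neg, Real.exp_add]
    ring
  have hdet := Real.rpow_pos_of_pos hW.det_pos (-(1 / 2 : ℝ))
  rw [h1, ENNReal.ofReal_mul (densS_pos s).le, ENNReal.ofReal_mul hdet.le,
    ENNReal.ofReal_mul (mul_pos (Real.exp_pos _) (densS_pos _)).le]
  rfl

/-- A charged level set would make the mean of S vanish almost everywhere for the tilted weight,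
hence for `wR`, as the tilt is strictly positive. That mean vanishes only if Δ = 0 or μ = 0. -/
theorem gaussS_ratio_eq_const {k : ℕ} {W : CovMat k} (hW : W.PosDef)
    {wR : Measure (ℝ × (Fin k → ℝ))} (hpos : 0 < wR {p | p.1 ≠ 0 ∧ p.2 ≠ 0}) (t : Fin k → ℝ)
    {c : ℝ≥0∞} (hc : c < ∞) : gaussS k {s | ratio wR W t s = c} = 0 := by
  refine gaussS_absolutelyContinuous k ?_
  have hC := ofReal_det_rpow_ne_zero hW
  have hset : ∀ s, ratio wR W t s = c ↔
      _ = c / ENNReal.ofReal (W.det ^ (-(1 / 2 : ℝ))) := fun s => by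
    rw [ratio_eq_laplace hW, ENNReal.eq_div_iff hC ENNReal.ofReal_ne_top]
  simp_rw [hset]
  refine volume_laplace_eq_const _ (measurable_meanS W) (fun h => hpos.ne' ?_)
    (ENNReal.div_lt_top hc.ne hC)
  have hd : Measurable fun p : ℝ × (Fin k → ℝ) =>
      ENNReal.ofReal (Real.exp (-(meanS W p ⬝ᵥ meanS W p / 2)) * densS (t - meanT W p)) := by
    simp only [dotProduct]
    fun_prop
  rw [ae_withDensity_iff hd] at h
  refine measure_mono_null (fun p hp => ?_) (ae_iff.mp h)
  intro h0
  have h1 : meanS W p = 0 :=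
    h0 (ENNReal.ofReal_pos.mpr (mul_pos (Real.exp_pos _) (densS_pos _))).ne'
  rcases smul_eq_zero.mp h1 with h | h
  · exact hp.1 h
  · exact hp.2 (scaleS_mulVec_eq_zero hW h)

/-- The conditional size of the region `{s | κ(t) < ratio}` is exactly `α`. -/
theorem critVal_spec {k : ℕ} {α : ℝ} (hα₀ : 0 < α) (hα₁ : α < 1) {W : CovMat k} (hW : W.PosDef)
    {wR : Measure (ℝ × (Fin k → ℝ))} [SFinite wR]
    (hfin : ∀ r₀ : DataMat k, intLik wR r₀ W < ∞) (hpos : 0 < wR {p | p.1 ≠ 0 ∧ p.2 ≠ 0})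
    (t : Fin k → ℝ) :
    critVal α wR t W < ∞ ∧
      gaussS k {s | critVal α wR t W < ratio wR W t s} = ENNReal.ofReal α := by
  rw [critVal_eq]
  exact measure_quantile_lt (gaussS k) (measurable_ratio_right hW wR t)
    (ratio_lt_top hfin t) (fun c hc => gaussS_ratio_eq_const hW hpos t hc) hα₀ hα₁

/-! ### Similarity and power, conditionally on T -/

/-- Under the null S is standard normal and independent of T, so the nuisance parameter enters only
as a shift of the law of T. -/
theorem rejProb_null_eq {k : ℕ} {φ : DataMat k → CovMat k → ℝ} (hφ : IsTest φ) {W : CovMat k}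
    (hW : W.PosDef) (μ : Fin k → ℝ) :
    rejProb φ 0 μ W = ∫⁻ t, ENNReal.ofReal (densS (t - meanT W (0, μ))) *
      ∫⁻ s, ENNReal.ofReal (φ (dataOfST W s t) W) ∂gaussS k := by
  have hC := ofReal_det_rpow_ne_zero hW
  rw [← ENNReal.mul_right_inj hC ENNReal.ofReal_ne_top]
  rw [rejProb_eq φ _ _ (fun r => hφ.nonneg r W),
    lintegral_dataOfST hW (F := fun r => ENNReal.ofReal (φ r W) * ENNReal.ofReal (densR r 0 μ W))
      ((hφ.measurable_section W).mul (measurable_densR_left hW 0 μ)),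
    ← lintegral_const_mul (f := fun t => ENNReal.ofReal (densS (t - meanT W (0, μ))) *
      ∫⁻ s, ENNReal.ofReal (φ (dataOfST W s t) W) ∂gaussS k) _
      (Measurable.mul (by fun_prop) (hφ.measurable_condSize W))]
  refine lintegral_congr fun t => ?_
  rw [lintegral_gaussS (hφ.measurable_section_left W t), ← mul_assoc,
    ← lintegral_const_mul (f := fun s => ENNReal.ofReal (densS s) *
      ENNReal.ofReal (φ (dataOfST W s t) W)) _
      (Measurable.mul (by fun_prop) (hφ.measurable_section_left W t))]
  refine lintegral_congr fun s => ?_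
  have hdet := Real.rpow_pos_of_pos hW.det_pos (-(1 / 2 : ℝ))
  have : densR (dataOfST W s t) 0 μ W =
      W.det ^ (-(1 / 2 : ℝ)) * densS (t - meanT W (0, μ)) * densS s := by
    rw [densR_dataOfST hW, zero_smul, sub_zero, mul_assoc, mul_comm (densS s)]
    rfl
  rw [this, ENNReal.ofReal_mul (mul_pos hdet (densS_pos _)).le, ENNReal.ofReal_mul hdet.le]
  ring

/-- Similarity is conditional size `α` given almost every value of `T`. -/
theorem isSimilarTest_iff {k : ℕ} {α : ℝ} (hα₁ : α < 1) {φ : DataMat k → CovMat k → ℝ}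
    (hφ : IsTest φ) {W : CovMat k} (hW : W.PosDef) :
    IsSimilarTest α W φ ↔
      ∀ᵐ t, ∫⁻ s, ENNReal.ofReal (φ (dataOfST W s t) W) ∂gaussS k = ENNReal.ofReal α := by
  have hα : ∀ m : Fin k → ℝ, ∫⁻ t : Fin k → ℝ, ENNReal.ofReal (densS (t - m)) * ENNReal.ofReal α =
      ENNReal.ofReal α := fun m => by
    rw [lintegral_mul_const _ (by fun_prop), lintegral_densS_sub, one_mul]
  constructor
  · rintro ⟨-, h⟩
    -- Completeness compares the conditional size with the constant α: similarity gives them equal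
    -- means under every shift.
    refine ae_eq_of_lintegral_densS_sub (h₂ := fun _ => ENNReal.ofReal α)
      (hφ.measurable_condSize W) measurable_const (fun t => ?_)
      (fun _ => by simpa using hα₁.le) fun m => ?_
    · refine (lintegral_mono (g := fun _ => 1) fun s => ?_).trans (by simp)
      simpa using hφ.le_one _ _
    · obtain ⟨μ, hμ⟩ := exists_nullT_mean_eq hW m
      have := h μ
      rw [rejProb_null_eq hφ hW] at this
      rw [hα, ← this, meanT, hμ]
  · refine fun h => ⟨hφ, fun μ => ?_⟩
    rw [rejProb_null_eq hφ hW, ← hα (meanT W (0, μ))]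
    refine lintegral_congr_ae ?_
    filter_upwards [h] with t ht
    rw [ht]

/-- Dividing the integrated likelihood by f_S lets the inner integral run over the null law of S,
the same measure that defines conditional size. -/
theorem det_mul_wap_eq {k : ℕ} {φ : DataMat k → CovMat k → ℝ} (hφ : IsTest φ) {W : CovMat k}
    (hW : W.PosDef) (wR : Measure (ℝ × (Fin k → ℝ))) [SFinite wR] :
    ENNReal.ofReal (W.det ^ (-(1 / 2 : ℝ))) * wap (wR.prod (Measure.dirac W)) φ =
      ∫⁻ t, ∫⁻ s, ENNReal.ofReal (φ (dataOfST W s t) W) * ratio wR W t s ∂gaussS k := by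
  rw [wap_eq hφ hW, lintegral_dataOfST hW (F := fun r => ENNReal.ofReal (φ r W) * intLik wR r W)
    ((hφ.measurable_section W).mul (measurable_intLik hW wR))]
  refine lintegral_congr fun t => ?_
  rw [lintegral_gaussS]
  · refine lintegral_congr fun s => ?_
    rw [mul_left_comm, densS_mul_ratio]
  · exact (hφ.measurable_section_left W t).mul (measurable_ratio_right hW wR t)

theorem rejProb_le_one {k : ℕ} {φ : DataMat k → CovMat k → ℝ} (hφ : IsTest φ) {W : CovMat k}
    (hW : W.PosDef) (Δ : ℝ) (μ : Fin k → ℝ) : rejProb φ Δ μ W ≤ 1 := by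
  have hC := ofReal_det_rpow_ne_zero hW
  have hdet := Real.rpow_pos_of_pos hW.det_pos (-(1 / 2 : ℝ))
  have hone : ∫⁻ r, ENNReal.ofReal (densR r Δ μ W) = 1 := by
    rw [← ENNReal.mul_right_inj hC ENNReal.ofReal_ne_top]
    rw [lintegral_dataOfST hW (measurable_densR_left hW Δ μ), mul_one]
    simp_rw [densR_dataOfST hW, ENNReal.ofReal_mul hdet.le, ENNReal.ofReal_mul (densS_pos _).le]
    have : ∀ t : Fin k → ℝ, ∫⁻ s : Fin k → ℝ, ENNReal.ofReal (W.det ^ (-(1 / 2 : ℝ))) *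
        (ENNReal.ofReal (densS (s - Δ • (scaleS W *ᵥ μ))) *
          ENNReal.ofReal (densS (t - nullT W (vecMulVec μ (aVec Δ))))) =
        ENNReal.ofReal (W.det ^ (-(1 / 2 : ℝ))) *
          ENNReal.ofReal (densS (t - nullT W (vecMulVec μ (aVec Δ)))) := fun t => by
      rw [lintegral_const_mul _ (by fun_prop), lintegral_mul_const _ (by fun_prop),
        lintegral_densS_sub, one_mul]
    simp_rw [this]
    rw [lintegral_const_mul _ (by fun_prop), lintegral_densS_sub, mul_one]
  rw [rejProb_eq φ _ _ (fun r => hφ.nonneg r W), ← hone]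
  exact lintegral_mono fun r =>
    mul_le_of_le_one_left' (by simpa using hφ.le_one r W)

theorem wap_lt_top {k : ℕ} {φ : DataMat k → CovMat k → ℝ} (hφ : IsTest φ) {W : CovMat k}
    (hW : W.PosDef) {wR : Measure (ℝ × (Fin k → ℝ))} [SFinite wR] (hw : wR Set.univ < ∞) :
    wap (wR.prod (Measure.dirac W)) φ < ∞ := by
  rw [wap, Measure.prod_dirac, (measurableEmbedding_prod_mk_right W).lintegral_map]
  calc _ ≤ ∫⁻ _, 1 ∂wR := lintegral_mono fun p => rejProb_le_one hφ hW _ _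
    _ < ∞ := by simpa using hw

/-! ### The likelihood ratio test: optimality and uniqueness -/

theorem rejects_dataOfST_iff {k : ℕ} (α β₀ : ℝ) {Sig : CovMat k} (hSig : Sig.PosDef)
    (wR : Measure (ℝ × (Fin k → ℝ))) (s t : Fin k → ℝ) :
    rejects α β₀ Sig wR (dataOfST (nullCov β₀ Sig) s t) ↔
      critVal α wR t (nullCov β₀ Sig) < ratio wR (nullCov β₀ Sig) t s := by
  have h := nullS_nullT_dataOfST (posDef_nullCov β₀ hSig) s t
  rw [rejects, statS_mul_inv, statT_mul_inv, h.1, h.2, ratio, gt_iff_lt]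

theorem measurableSet_rejects {k : ℕ} (α β₀ : ℝ) {Sig : CovMat k} (hSig : Sig.PosDef)
    (wR : Measure (ℝ × (Fin k → ℝ))) [SFinite wR] :
    MeasurableSet {r | rejects α β₀ Sig wR r} := by
  have hW := posDef_nullCov β₀ hSig
  simp only [rejects, statS_mul_inv, statT_mul_inv, gt_iff_lt]
  exact measurableSet_lt ((measurable_critVal α hW wR).comp (measurable_nullT _))
    ((measurable_intLik hW wR).div
      (measurable_densS.comp (measurable_nullS _)).ennreal_ofReal)

/-- The determinant factor times the power of the likelihood ratio test. -/
noncomputable def maxPower {k : ℕ} (α : ℝ) (wR : Measure (ℝ × (Fin k → ℝ))) (W : CovMat k) :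
    ℝ≥0∞ :=
  ∫⁻ t, ∫⁻ s in {s | critVal α wR t W < ratio wR W t s}, ratio wR W t s ∂gaussS k

open Classical in
/-- The rejection indicator, as a test that ignores the variance datum. -/
noncomputable def lrTest {k : ℕ} (α β₀ : ℝ) (Sig : CovMat k) (wR : Measure (ℝ × (Fin k → ℝ))) :
    DataMat k → CovMat k → ℝ :=
  fun r _ => if rejects α β₀ Sig wR r then 1 else 0

theorem isTest_lrTest {k : ℕ} (α β₀ : ℝ) {Sig : CovMat k} (hSig : Sig.PosDef)
    (wR : Measure (ℝ × (Fin k → ℝ))) [SFinite wR] : IsTest (lrTest α β₀ Sig wR) where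
  measurable := by
    have h : Measurable fun r : DataMat k => lrTest α β₀ Sig wR r 0 :=
      Measurable.ite (measurableSet_rejects α β₀ hSig wR) measurable_const measurable_const
    have heq : Function.uncurry (lrTest α β₀ Sig wR) =
        (fun r => lrTest α β₀ Sig wR r 0) ∘ Prod.fst := by
      funext ⟨r, σ⟩
      rfl
    rw [heq]
    exact h.comp measurable_fst
  nonneg r _ := by unfold lrTest; split_ifs <;> norm_num
  le_one r _ := by unfold lrTest; split_ifs <;> norm_num

section

variable {k : ℕ} {α β₀ : ℝ} {Sig : CovMat k} {wR : Measure (ℝ × (Fin k → ℝ))} [SFinite wR]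
  {φ : DataMat k → CovMat k → ℝ}

/-- The change of variables preserves null sets, and the everywhere positive density f_S makes
Gaussian and Lebesgue null sets coincide. -/
theorem ae_eq_lrTest_iff (hSig : Sig.PosDef) (hφ : IsTest φ) :
    (∀ᵐ r, φ r (nullCov β₀ Sig) = lrTest α β₀ Sig wR r (nullCov β₀ Sig)) ↔
      ∀ᵐ t, ∀ᵐ s ∂gaussS k, ENNReal.ofReal (φ (dataOfST (nullCov β₀ Sig) s t) (nullCov β₀ Sig)) =
        {s | critVal α wR t (nullCov β₀ Sig) < ratio wR (nullCov β₀ Sig) t s}.indicator 1 s := by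
  have hW := posDef_nullCov β₀ hSig
  have hae : ae (gaussS k) = ae (volume : Measure (Fin k → ℝ)) :=
    le_antisymm (gaussS_absolutelyContinuous k).ae_le (absolutelyContinuous_gaussS k).ae_le
  have hm₁ := hφ.measurable_apply (nullCov β₀ Sig)
  have hm₂ := (isTest_lrTest α β₀ hSig wR).measurable_apply (nullCov β₀ Sig)
  rw [ae_dataMat_iff hW (measurableSet_eq_fun hm₁ hm₂), hae]
  have hpt : ∀ s t, φ (dataOfST (nullCov β₀ Sig) s t) (nullCov β₀ Sig) =
      lrTest α β₀ Sig wR (dataOfST (nullCov β₀ Sig) s t) (nullCov β₀ Sig) ↔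
      ENNReal.ofReal (φ (dataOfST (nullCov β₀ Sig) s t) (nullCov β₀ Sig)) =
        {s | critVal α wR t (nullCov β₀ Sig) < ratio wR (nullCov β₀ Sig) t s}.indicator 1 s := by
    intro s t
    have h0 := hφ.nonneg (dataOfST (nullCov β₀ Sig) s t) (nullCov β₀ Sig)
    by_cases h : critVal α wR t (nullCov β₀ Sig) < ratio wR (nullCov β₀ Sig) t s
    · rw [lrTest, if_pos ((rejects_dataOfST_iff α β₀ hSig wR s t).mpr h),
        Set.indicator_of_mem (by exact h), Pi.one_apply, ENNReal.ofReal_eq_one]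
    · rw [lrTest, if_neg (mt (rejects_dataOfST_iff α β₀ hSig wR s t).mp h),
        Set.indicator_of_notMem (by exact h), ENNReal.ofReal_eq_zero]
      exact ⟨fun h => h.le, fun h => le_antisymm h h0⟩
  simp_rw [hpt]

theorem similar_and_wap_of_ae_eq_lrTest (hα₀ : 0 < α) (hα₁ : α < 1) (hSig : Sig.PosDef)
    (hfin : ∀ r₀ : DataMat k, intLik wR r₀ (nullCov β₀ Sig) < ∞)
    (hpos : 0 < wR {p | p.1 ≠ 0 ∧ p.2 ≠ 0}) (hφ : IsTest φ)
    (h : ∀ᵐ r, φ r (nullCov β₀ Sig) = lrTest α β₀ Sig wR r (nullCov β₀ Sig)) :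
    IsSimilarTest α (nullCov β₀ Sig) φ ∧
      ENNReal.ofReal ((nullCov β₀ Sig).det ^ (-(1 / 2 : ℝ))) *
        wap (wR.prod (Measure.dirac (nullCov β₀ Sig))) φ = maxPower α wR (nullCov β₀ Sig) := by
  have hW := posDef_nullCov β₀ hSig
  rw [ae_eq_lrTest_iff hSig hφ] at h
  have hset : ∀ t, MeasurableSet
      {s | critVal α wR t (nullCov β₀ Sig) < ratio wR (nullCov β₀ Sig) t s} := fun t =>
    measurableSet_lt measurable_const (measurable_ratio_right hW wR t)
  constructor
  · rw [isSimilarTest_iff hα₁ hφ hW]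
    filter_upwards [h] with t ht
    rw [lintegral_congr_ae ht, lintegral_indicator_one (hset t),
      (critVal_spec hα₀ hα₁ hW hfin hpos t).2]
  · rw [det_mul_wap_eq hφ hW, maxPower]
    refine lintegral_congr_ae ?_
    filter_upwards [h] with t ht
    rw [← lintegral_indicator (hset t)]
    refine lintegral_congr_ae ?_
    filter_upwards [ht] with s hs
    rw [hs]
    by_cases hc : critVal α wR t (nullCov β₀ Sig) < ratio wR (nullCov β₀ Sig) t s
    · rw [Set.indicator_of_mem (by exact hc), Set.indicator_of_mem (by exact hc), Pi.one_apply,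
        one_mul]
    · rw [Set.indicator_of_notMem (by exact hc), Set.indicator_of_notMem (by exact hc), zero_mul]

/-- Neyman-Pearson is applied separately for each t at which the conditional size is α, which
similarity guarantees only for almost every t. -/
theorem ae_condPower_le {W : CovMat k} (hα₀ : 0 < α) (hα₁ : α < 1) (hW : W.PosDef)
    (hfin : ∀ r₀ : DataMat k, intLik wR r₀ W < ∞)
    (hpos : 0 < wR {p | p.1 ≠ 0 ∧ p.2 ≠ 0}) (hφ : IsSimilarTest α W φ) :
    ∀ᵐ t, ∫⁻ s, ENNReal.ofReal (φ (dataOfST W s t) W) * ratio wR W t s ∂gaussS k ≤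
        ∫⁻ s in {s | critVal α wR t W < ratio wR W t s}, ratio wR W t s ∂gaussS k ∧
      (∫⁻ s in {s | critVal α wR t W < ratio wR W t s}, ratio wR W t s ∂gaussS k < ∞ →
        ∫⁻ s, ENNReal.ofReal (φ (dataOfST W s t) W) * ratio wR W t s ∂gaussS k =
          ∫⁻ s in {s | critVal α wR t W < ratio wR W t s}, ratio wR W t s ∂gaussS k →
        ∀ᵐ s ∂gaussS k, ENNReal.ofReal (φ (dataOfST W s t) W) =
          {s | critVal α wR t W < ratio wR W t s}.indicator 1 s) := by
  filter_upwards [(isSimilarTest_iff hα₁ hφ.1 hW).mp hφ] with t ht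
  have hcrit := critVal_spec hα₀ hα₁ hW hfin hpos t
  have h := neyman_pearson (gaussS k) (measurable_ratio_right hW wR t)
    (hφ.1.measurable_section_left W t) (fun s => by simpa using hφ.1.le_one _ _) hcrit.1
    ENNReal.ofReal_lt_top ht hcrit.2
  exact ⟨h.1, h.2 (ratio_lt_top hfin t) (gaussS_ratio_eq_const hW hpos t hcrit.1)⟩

theorem det_mul_wap_le_maxPower {W : CovMat k} (hα₀ : 0 < α) (hα₁ : α < 1) (hW : W.PosDef)
    (hfin : ∀ r₀ : DataMat k, intLik wR r₀ W < ∞)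
    (hpos : 0 < wR {p | p.1 ≠ 0 ∧ p.2 ≠ 0}) (hφ : IsSimilarTest α W φ) :
    ENNReal.ofReal (W.det ^ (-(1 / 2 : ℝ))) * wap (wR.prod (Measure.dirac W)) φ ≤
      maxPower α wR W := by
  rw [det_mul_wap_eq hφ.1 hW, maxPower]
  refine lintegral_mono_ae ?_
  filter_upwards [ae_condPower_le hα₀ hα₁ hW hfin hpos hφ] with t ht using ht.1

theorem isOptimalSimilarTest_of_ae_eq_lrTest (hα₀ : 0 < α) (hα₁ : α < 1) (hSig : Sig.PosDef)
    (hfin : ∀ r₀ : DataMat k, intLik wR r₀ (nullCov β₀ Sig) < ∞)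
    (hpos : 0 < wR {p | p.1 ≠ 0 ∧ p.2 ≠ 0}) (hφ : IsTest φ)
    (h : ∀ᵐ r, φ r (nullCov β₀ Sig) = lrTest α β₀ Sig wR r (nullCov β₀ Sig)) :
    IsOptimalSimilarTest α (nullCov β₀ Sig) wR φ := by
  have hW := posDef_nullCov β₀ hSig
  have hs := similar_and_wap_of_ae_eq_lrTest hα₀ hα₁ hSig hfin hpos hφ h
  refine ⟨hs.1, fun φ' hφ' => ?_⟩
  have hle := det_mul_wap_le_maxPower hα₀ hα₁ hW hfin hpos hφ'
  rw [← hs.2] at hle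
  exact (ENNReal.mul_le_mul_iff_right (ofReal_det_rpow_ne_zero hW) ENNReal.ofReal_ne_top).mp hle

theorem ae_eq_lrTest_of_isOptimalSimilarTest (hα₀ : 0 < α) (hα₁ : α < 1) (hSig : Sig.PosDef)
    (hfin : ∀ r₀ : DataMat k, intLik wR r₀ (nullCov β₀ Sig) < ∞)
    (hpos : 0 < wR {p | p.1 ≠ 0 ∧ p.2 ≠ 0}) (hw : wR Set.univ < ∞)
    (hφ : IsOptimalSimilarTest α (nullCov β₀ Sig) wR φ) :
    ∀ᵐ r, φ r (nullCov β₀ Sig) = lrTest α β₀ Sig wR r (nullCov β₀ Sig) := by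
  have hW := posDef_nullCov β₀ hSig
  have htest := isTest_lrTest α β₀ hSig wR
  have hlr := similar_and_wap_of_ae_eq_lrTest hα₀ hα₁ hSig hfin hpos htest
    (Filter.Eventually.of_forall fun _ => rfl)
  -- Finite weight enters here. Finite maximal power is what allows equality of integrals to be read
  -- back as equality for almost every t, and then for almost every s.
  have hpow : maxPower α wR (nullCov β₀ Sig) < ∞ := by
    rw [← hlr.2]
    exact ENNReal.mul_lt_top ENNReal.ofReal_lt_top (wap_lt_top htest hW hw)
  have hge : maxPower α wR (nullCov β₀ Sig) ≤
      ∫⁻ t, ∫⁻ s, ENNReal.ofReal (φ (dataOfST (nullCov β₀ Sig) s t) (nullCov β₀ Sig)) *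
        ratio wR (nullCov β₀ Sig) t s ∂gaussS k := by
    rw [← det_mul_wap_eq hφ.1.1 hW, ← hlr.2]
    gcongr
    exact hφ.2 _ hlr.1
  have hmeas : Measurable fun t => ∫⁻ s in {s | critVal α wR t (nullCov β₀ Sig) <
      ratio wR (nullCov β₀ Sig) t s}, ratio wR (nullCov β₀ Sig) t s ∂gaussS k := by
    have hset : MeasurableSet {p : (Fin k → ℝ) × (Fin k → ℝ) |
        critVal α wR p.1 (nullCov β₀ Sig) < ratio wR (nullCov β₀ Sig) p.1 p.2} :=
      measurableSet_lt ((measurable_critVal α hW wR).comp measurable_fst) (measurable_ratio hW wR)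
    have h := ((measurable_ratio hW wR).indicator hset).lintegral_prod_right' (ν := gaussS k)
    convert h using 2 with t
    rw [← lintegral_indicator (measurableSet_lt measurable_const
      (measurable_ratio_right hW wR t))]
    rfl
  have hcond := ae_condPower_le hα₀ hα₁ hW hfin hpos hφ.1
  have hle := hcond.mono fun t ht => ht.1
  have hfin_le := (lintegral_mono_ae hle).trans_lt hpow
  -- Conditional power is bounded by that of the likelihood ratio test for almost every t, while
  -- optimality gives the reverse inequality for the integrals.
  have heq := ae_eq_of_ae_le_of_lintegral_le hle hfin_le.ne hmeas.aemeasurable hge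
  rw [ae_eq_lrTest_iff hSig hφ.1.1]
  filter_upwards [hcond, heq, ae_lt_top hmeas hpow.ne] with t h1 h2 h3
  exact h1.2 h3 h2

end

end WAPSimilar

open Classical WAPSimilar in
theorem mainTheorem5 (k : ℕ) (α : ℝ) (hα₀ : 0 < α) (hα₁ : α < 1)
    (β₀ : ℝ) (Sig : CovMat k) (hSig : Sig.PosDef)
    (wR : Measure (ℝ × (Fin k → ℝ)))
    (hfin : ∀ r₀ : DataMat k, intLik wR r₀ (nullCov β₀ Sig) < ∞)
    (hpos : 0 < wR {p | p.1 ≠ 0 ∧ p.2 ≠ 0}) :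
    (∃ φ : DataMat k → CovMat k → ℝ,
      IsOptimalSimilarTest α (nullCov β₀ Sig) wR φ ∧
      ∀ r₀ : DataMat k, φ r₀ (nullCov β₀ Sig) = if rejects α β₀ Sig wR r₀ then 1 else 0) ∧
    (∀ φ : DataMat k → CovMat k → ℝ, IsTest φ →
      (∀ᵐ r₀ : DataMat k, φ r₀ (nullCov β₀ Sig) = if rejects α β₀ Sig wR r₀ then 1 else 0) →
      IsOptimalSimilarTest α (nullCov β₀ Sig) wR φ) ∧
    (wR Set.univ < ∞ →
      ∀ φ : DataMat k → CovMat k → ℝ,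
        IsOptimalSimilarTest α (nullCov β₀ Sig) wR φ →
        ∀ᵐ r₀ : DataMat k,
          φ r₀ (nullCov β₀ Sig) = if rejects α β₀ Sig wR r₀ then 1 else 0) := by
  have := sigmaFinite_of_intLik_lt_top (posDef_nullCov β₀ hSig) hfin
  refine ⟨⟨lrTest α β₀ Sig wR, ?_, fun _ => rfl⟩, fun φ hφ h => ?_, fun hw φ hφ => ?_⟩
  · exact isOptimalSimilarTest_of_ae_eq_lrTest hα₀ hα₁ hSig hfin hpos
      (isTest_lrTest α β₀ hSig wR) (Filter.Eventually.of_forall fun _ => rfl)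
  · exact isOptimalSimilarTest_of_ae_eq_lrTest hα₀ hα₁ hSig hfin hpos hφ h
  · exact ae_eq_lrTest_of_isOptimalSimilarTest hα₀ hα₁ hSig hfin hpos hw hφ
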